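/- **Conventions.** A *simplicial complex* is a finite family $\Sigma$ of finite sets of integers (faces) with $\emptyset\in\Sigma$ that is closed under taking subsets. A face $F$ has dimension $|F|-1$; $\Sigma_i$ is the set of $i$-dimensional faces; $\dim\Sigma$ is the largest dimension of a face; the vertices of $\Sigma$ are the integers $v$ with $\{v\}\in\Sigma$. $\Sigma$ is *shifted* on the integer interval $[a,b]$ if every face is a subset of $[a,b]$ and, whenever $a\le i<j$, $F\in\Sigma$, $i\notin F$, $j\in F$, then $(F\setminus\{j\})\cup\{i\}\in\Sigma$. The pure $i$-skeleton is $\Sigma_{[i]}=\{F\in\Sigma: F\subseteq G\text{ for some }G\in\Sigma_i\}$. Further, $\mathrm{del}_p\Sigma=\{F\setminus\{p\}:F\in\Sigma\}$, $\mathrm{link}_p\Sigma=\{F: p\notin F,\ F\cup\{p\}\in\Sigma\}$, and $\tilde\beta_i$ is the $i$-th reduced Betti number (the rank of $\tilde H_i(\,\cdot\,;\mathbb Z)$). Let $K$ be a field of characteristic $0$, let $x_{k,v}$ $(k,v\in\mathbb Z)$ be indeterminates, and let $\Bbbk=K(x_{k,v})$. Let $\uparrow$ be the $K$-automorphism of $\Bbbk$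 with $\uparrow x_{k,v}=x_{k+1,v}$. For a multiset $S=\{i_1\le\dots\le i_m\}$ of integers put $x_S=x_{1,i_1}\cdots x_{m,i_m}$ and $X_S=x_S^2$. For multisets $S,T$ put $$z(S,T)=\frac1{\uparrow X_S}\sum_{j\in T}X_{S\cup j}\qquad(\cup\text{ the multiset union, adding multiplicities}).$$ For a complex $\Omega$ of dimension $e$, let $C_i(\Omega)$ be the $\Bbbk$-vector space with basis $\{[F]:F\in\Omega_i\}$, and set $$\partial_i[F]=\sum_{j\in F}\varepsilon(j,F)\frac{\uparrow^{e-i}x_F}{\uparrow^{e-i+1}x_{F\setminus j}}[F\setminus j],\qquad \partial^*_{i+1}[F]=\sum_{j\notin F,\ F\cup j\in\Omega}\varepsilon(j,F\cup j)\frac{\uparrow^{e-i-1}x_{F\cup j}}{\uparrow^{e-i}x_F}[F\cup j]\qquad(F\in\Omega_i),$$ where $\varepsilon(v,F)=(-1)^{k+1}$ if $v$ is the $k$-th smallest element of $F$. Let $\mathbf s_i(\Omega)$ be the multiset of eigenvalues, in an algebraic closure of $\Bbbk$ and with multiplicity, of the algebraic finely weighted up-down Laplacian $\partial_{i+1}\partial^*_{i+1}$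 on $C_i(\Omega)$. Write $\overset{\circ}{=}$ for equality of multisets up to the multiplicity of $0$. **Theorem 7.2.** Let $\Sigma$ be a shifted simplicial complex of dimension $d$ on an integer interval. 1. For every integer $i$, every nonzero element of $\mathbf s_{i-1}(\Sigma)$ equals $\uparrow^{d-i}z(S,T)$ for some sets $S,T$ of vertices of $\Sigma$. 2. If $\Sigma$ has no vertices, then $\mathbf s_{i-1}(\Sigma)$ has no nonzero elements, for every integer $i$. 3. Let $0\le i\le d$. Then $\Sigma_{[i]}$ has a smallest vertex $p$. Put $\Delta=\mathrm{del}_p\,\Sigma_{[i]}$ and $\Lambda=\mathrm{link}_p\,\Sigma_{[i]}$, and write $\tilde S=S\cup\{p\}$, $\tilde T=T\cup\{p\}$. The nonzero elements of $\mathbf s_{i-1}(\Delta)$ can be written, with multiplicity, as $z(S,T)$ with $S,T$ sets of vertices of $\Delta$, and those of $\mathbf s_{i-2}(\Lambda)$ as $z(S,T)$ with $S,T$ sets of vertices of $\Lambda$. For every way of writing these nonzero eigenvalues, with multiplicity, as $z(S,T)$ with $S,T$ finite sets of integers greater than $p$, $$\mathbf s_{i-1}(\Sigma)\overset{\circ}{=}\{\uparrow^{d-i}z(S,\tilde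 T): 0\ne z(S,T)\in\mathbf s_{i-1}(\Delta)\}\ \cup\ \{\uparrow^{d-i}z(\tilde S,\tilde T): 0\ne z(S,T)\in\mathbf s_{i-2}(\Lambda)\}\ \cup\ \{\uparrow^{d-i}z(\emptyset,\{p\})\}^{\tilde\beta_{i-1}(\Delta)},$$ where $\cup$ is the multiset union and the exponent is a multiplicity. -/

import Mathlib

/-!
Finite simplicial complexes on integer vertices, shifted complexes, the algebraic finely weighted
up-down Laplacian, its spectrum, and z-polynomials.

A complex is a finite family of finite sets of integers that contains the empty set and is closed
under taking subsets.  Dimensions are integers: the empty face has dimension `-1`.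
-/

namespace FineShifted

noncomputable section

/-- A simplicial complex: the empty set is a face and subsets of faces are faces. -/
structure IsSimplicialComplex (C : Finset (Finset ℤ)) : Prop where
  empty_mem : ∅ ∈ C
  down_closed : ∀ F ∈ C, ∀ G ⊆ F, G ∈ C

/-- `C` is a shifted simplicial complex on the vertex set `[a, b] = {a, a + 1, …, b}`. -/
structure IsShiftedComplex (C : Finset (Finset ℤ)) (a b : ℤ) : Prop
    extends IsSimplicialComplex C where
  subset_interval : ∀ F ∈ C, F ⊆ Finset.Icc a b
  exchange : ∀ F ∈ C, ∀ i j : ℤ, a ≤ i → i < j → i ∉ F → j ∈ F → insert i (F.erase j) ∈ C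

/-- The vertices of a complex, as the integers `v` such that `{v}` is a face. -/
def vertices (C : Finset (Finset ℤ)) : Set ℤ := {v | {v} ∈ C}

/-- The dimension of a complex: the largest dimension `|F| - 1` of a face. -/
def dimension (C : Finset (Finset ℤ)) : ℤ := ((C.sup Finset.card : ℕ) : ℤ) - 1

/-- The set of `i`-dimensional faces. -/
def facesOfDim (C : Finset (Finset ℤ)) (i : ℤ) : Finset (Finset ℤ) :=
  C.filter fun F => (F.card : ℤ) = i + 1

/-- The pure `i`-skeleton: the subcomplex generated by the `i`-dimensional faces. -/
def pureSkeleton (C : Finset (Finset ℤ)) (i : ℤ) : Finset (Finset ℤ) :=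
  C.filter fun F => ∃ G ∈ facesOfDim C i, F ⊆ G

/-- The deletion `{F \ {p} : F ∈ C}`. -/
def deletion (C : Finset (Finset ℤ)) (p : ℤ) : Finset (Finset ℤ) :=
  C.image fun F => F.erase p

/-- The link `{F : p ∉ F, F ∪ {p} ∈ C}`; as `C` is closed under subsets, such an `F` is in `C`. -/
def link (C : Finset (Finset ℤ)) (p : ℤ) : Finset (Finset ℤ) :=
  C.filter fun F => p ∉ F ∧ insert p F ∈ C

/-- The sign `(-1) ^ (k + 1)` where `v` is the `k`-th smallest element of `F`; zero if `v ∉ F`. -/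
def sgn (v : ℤ) (F : Finset ℤ) : ℤ :=
  if v ∈ F then (-1) ^ (F.filter fun u => u < v).card else 0

/-- The matrix of the (unweighted) simplicial boundary map `∂_{i+1} : C_{i+1} → C_i` over `ℤ`,
`[G] ↦ ∑_{j ∈ G} ε(j, G) [G \ j]`.  Columns are indexed by the `(i+1)`-dimensional faces and rows by
the `i`-dimensional faces. -/
def boundary (C : Finset (Finset ℤ)) (i : ℤ) :
    Matrix (facesOfDim C i) (facesOfDim C (i + 1)) ℤ :=
  fun F G => ∑ j ∈ G.1, if G.1.erase j = F.1 then sgn j G.1 else 0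

/-- The `(i+1)`-st reduced simplicial homology group over `ℤ`, `ker ∂_{i+1} / im ∂_{i+2}`. -/
abbrev reducedHomologySucc (C : Finset (Finset ℤ)) (i : ℤ) : Type :=
  LinearMap.ker (boundary C i).mulVecLin ⧸
    (LinearMap.range (boundary C (i + 1)).mulVecLin).submoduleOf
      (LinearMap.ker (boundary C i).mulVecLin)

/-- The `(i+1)`-st reduced Betti number: the rank of the `(i+1)`-st reduced integral homology. -/
def bettiSucc (C : Finset (Finset ℤ)) (i : ℤ) : ℕ :=
  Module.finrank ℤ (reducedHomologySucc C i)

/-- The field of rational functions over `K` in the indeterminates `x_{k,v}`, for integers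
`k` and `v`. -/
abbrev RatFun (K : Type*) [Field K] : Type _ := FractionRing (MvPolynomial (ℤ × ℤ) K)

section Weights

variable (K : Type*) [Field K]

/-- The indeterminate `x_{k,v}`. -/
def x (k v : ℤ) : RatFun K := algebraMap (MvPolynomial (ℤ × ℤ) K) (RatFun K) (MvPolynomial.X (k, v))

/-- The raising operator: the automorphism of the field of rational functions with
`x_{k,v} ↦ x_{k+1,v}` and fixing `K`. -/
def raise : RatFun K ≃+* RatFun K :=
  IsFractionRing.ringEquivOfRingEquiv
    (MvPolynomial.renameEquiv K
      ((Equiv.addRight (1 : ℤ)).prodCongr (Equiv.refl ℤ))).toRingEquiv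

/-- The `a`-th iterate of the raising operator. -/
def raisePow (a : ℤ) (r : RatFun K) : RatFun K := (raise K ^ a : RingAut (RatFun K)) r

/-- `x_S = x_{1,i_1} x_{2,i_2} ⋯ x_{m,i_m}` for the multiset `S = {i_1 ≤ i_2 ≤ ⋯ ≤ i_m}`. -/
def xMon (S : Multiset ℤ) : RatFun K :=
  (S.sort.mapIdx fun k v => x K ((k : ℤ) + 1) v).prod

/-- `X_S = x_S ^ 2`. -/
def XMon (S : Multiset ℤ) : RatFun K := xMon K S ^ 2

/-- The Laurent polynomial `z(S, T) = (1 / ↑X_S) ∑_{j ∈ T} X_{S ∪ j}`, where `S ∪ j` is a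
multiset union, so that the multiplicity of `j` goes up by one. -/
def zPoly (S T : Multiset ℤ) : RatFun K :=
  (raisePow K 1 (XMon K S))⁻¹ * (T.map fun j => XMon K (j ::ₘ S)).sum

/-- The matrix of the algebraic finely weighted boundary map `C_{i+1} → C_i`: with `d` the dimension
of the complex, `[G] ↦ ∑_{j ∈ G} ε(j, G) (↑^{d-(i+1)} x_G / ↑^{d-(i+1)+1} x_{G \ j}) [G \ j]`. -/
def algBoundary (C : Finset (Finset ℤ)) (i : ℤ) :
    Matrix (facesOfDim C i) (facesOfDim C (i + 1)) (RatFun K) :=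
  fun F G => ∑ j ∈ G.1, if G.1.erase j = F.1 then
    (sgn j G.1 : RatFun K) *
      (raisePow K (dimension C - (i + 1)) (xMon K G.1.val) /
        raisePow K (dimension C - (i + 1) + 1) (xMon K (G.1.erase j).val))
    else 0

/-- The matrix of the algebraic finely weighted coboundary map `C_i → C_{i+1}`:
`[F] ↦ ∑_{j ∉ F} ε(j, F ∪ j) (↑^{d-i-1} x_{F ∪ j} / ↑^{d-i} x_F) [F ∪ j]`. -/
def algCoboundary (C : Finset (Finset ℤ)) (i : ℤ) :
    Matrix (facesOfDim C (i + 1)) (facesOfDim C i) (RatFun K) :=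
  fun G F => ∑ j ∈ G.1 \ F.1, if insert j F.1 = G.1 then
    (sgn j G.1 : RatFun K) *
      (raisePow K (dimension C - i - 1) (xMon K G.1.val) /
        raisePow K (dimension C - i) (xMon K F.1.val))
    else 0

/-- The algebraic finely weighted up-down Laplacian on `i`-dimensional chains. -/
def upDownLaplacian (C : Finset (Finset ℤ)) (i : ℤ) :
    Matrix (facesOfDim C i) (facesOfDim C i) (RatFun K) :=
  algBoundary K C i * algCoboundary K C i

/-- The multiset of eigenvalues of the up-down Laplacian on `i`-dimensional chains, taken in an
algebraic closure of the field of rational functions, with multiplicity (as roots of the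
characteristic polynomial). -/
def upDownSpectrum (C : Finset (Finset ℤ)) (i : ℤ) : Multiset (AlgebraicClosure (RatFun K)) :=
  (upDownLaplacian K C i).charpoly.aroots (AlgebraicClosure (RatFun K))

/-- The rational function `r` as an element of the algebraic closure. -/
def emb (r : RatFun K) : AlgebraicClosure (RatFun K) := algebraMap _ _ r

end Weights

open Classical in
/-- The nonzero part of a multiset.  Two multisets agree up to the multiplicity of zero exactly if
their nonzero parts are equal. -/
def nonzeroPart {α : Type*} [Zero α] (M : Multiset α) : Multiset α := M.filter fun r => r ≠ 0

/-- Equality of multisets up to the multiplicity of zero. -/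
def EqUpToZero {α : Type*} [Zero α] (M N : Multiset α) : Prop := nonzeroPart M = nonzeroPart N

end

end FineShifted

open FineShifted

/-! Let `𝓖` be the family of `i`-faces of `Σ` and `p` the left end of the interval. Shiftedness
makes `𝓖` a near-cone with apex `p`: deleting any vertex from a face without `p` leaves a face of
the link of `p`. Hence the weighted boundary matrix of `𝓖` equals `x⁻¹ P T` with `x = x_{1,p}`,
factoring through chains on `linkFamily p 𝓖`; here `P` consists of the columns of faces containing
`p`, and `T` of the rows indexed by the link.

One computes `T Tᵗ = x² + A`, with `A` the Laplacian of the deletion, and `Pᵗ P = x² + B`, with `B`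
equal to `x_{1,p}² / x_{2,p}²` times the raised down-up Laplacian of the link. Since a boundary has
no boundary, `A B = 0`. The nonzero spectrum of a product does not depend on the order of the
factors, so the Laplacian of `𝓖` has the nonzero spectrum of `x⁻² (x² + A)(x² + B) = x² + A + B`,
which `A B = 0` splits into shifts by `x²` of the nonzero spectra of `A` and `B`, and copies of `x²`
(`HasNonzeroEigenvalues.scalar_add`, `IsNearCone.hasNonzeroEigenvalues`). No shifted value vanishes,
because all of them are positive at `x_{k,v} = 1`.

The shifts are exactly what happens to `z(S, T)` when `p` is adjoined to `T`, or to both sets, so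
induction on the length of the interval shows that all nonzero eigenvalues are `z`-polynomials. The
copies of `x²` number `|linkFamily p 𝓖|` minus the nonzero eigenvalues of `A` and `B`. The first
term counts the `(i-1)`-faces of `Δ`, and the numbers of eigenvalues are the ranks of its two
adjacent boundary maps, so the difference is a Betti number of `Δ`. -/

open scoped FinsetFamily

open Polynomial in
/-- `R` is the multiset of nonzero eigenvalues of `M`, all of which lie in the base field. -/
def HasNonzeroEigenvalues {F n : Type*} [Field F] [Fintype n] [DecidableEq n]
    (M : Matrix n n F) (R : Multiset F) : Prop :=
  0 ∉ R ∧ ∃ k : ℕ, M.charpoly = X ^ k * (R.map fun r => X - C r).prod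

/-! ### Nonzero spectra of matrices via characteristic polynomials. -/

section LinearAlgebra

open Polynomial

theorem eval_zero_prod_X_sub_C_ne_zero {F : Type*} [Field F] {R : Multiset F} (h : 0 ∉ R) :
    (R.map fun r => X - C r).prod.eval 0 ≠ 0 := by
  rw [eval_multiset_prod, Multiset.map_map, Ne, Multiset.prod_eq_zero_iff, Multiset.mem_map]
  rintro ⟨r, hr, h0⟩
  simp only [Function.comp_apply, eval_sub, eval_X, eval_C, zero_sub, neg_eq_zero] at h0
  exact h (h0 ▸ hr)

/-- The product over `R` does not vanish at `0`, so all powers of `X` on the right sit in `X ^ b`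
and the surplus over `X ^ a` can be cancelled. -/
theorem eq_X_pow_mul_of_X_pow_mul_eq {F : Type*} [Field F] {R : Multiset F} (h : 0 ∉ R)
    {f : F[X]} {a b : ℕ} (hf : X ^ a * f = X ^ b * (R.map fun r => X - C r).prod) :
    ∃ c, b = a + c ∧ f = X ^ c * (R.map fun r => X - C r).prod := by
  rcases le_or_gt a b with hab | hab
  · obtain ⟨c, rfl⟩ := Nat.exists_eq_add_of_le hab
    refine ⟨c, rfl, ?_⟩
    rw [pow_add, mul_assoc] at hf
    exact mul_left_cancel₀ (pow_ne_zero _ X_ne_zero) hf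
  · exfalso
    obtain ⟨c, rfl⟩ := Nat.exists_eq_add_of_lt hab
    rw [add_assoc, pow_add, mul_assoc] at hf
    have := mul_left_cancel₀ (pow_ne_zero _ X_ne_zero) hf
    apply eval_zero_prod_X_sub_C_ne_zero h
    rw [← this]
    simp

theorem natDegree_X_pow_mul_prod {F : Type*} [Field F] (k : ℕ) (R : Multiset F) :
    (X ^ k * (R.map fun r => X - C r).prod).natDegree = k + R.card := by
  rw [natDegree_mul (pow_ne_zero _ X_ne_zero)
    (monic_multiset_prod_of_monic _ _ fun r _ => monic_X_sub_C r).ne_zero, natDegree_X_pow,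
    natDegree_multiset_prod_X_sub_C_eq_card]

namespace HasNonzeroEigenvalues

variable {F n m : Type*} [Field F] [Fintype n] [DecidableEq n] [Fintype m] [DecidableEq m]

theorem mul_comm {A : Matrix m n F} {B : Matrix n m F} {R : Multiset F}
    (h : HasNonzeroEigenvalues (A * B) R) : HasNonzeroEigenvalues (B * A) R := by
  obtain ⟨h0, k, hk⟩ := h
  refine ⟨h0, ?_⟩
  have := Matrix.charpoly_mul_comm' A B
  rw [hk, ← mul_assoc, ← pow_add] at this
  obtain ⟨c, -, hc⟩ := eq_X_pow_mul_of_X_pow_mul_eq h0 this.symm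
  exact ⟨c, hc⟩

theorem zero : HasNonzeroEigenvalues (0 : Matrix n n F) 0 :=
  ⟨Multiset.notMem_zero _, Fintype.card n, by simp⟩

theorem map {E : Type*} [Field E] (f : F →+* E) {M : Matrix n n F} {R : Multiset F}
    (h : HasNonzeroEigenvalues M R) : HasNonzeroEigenvalues (M.map f) (R.map f) := by
  obtain ⟨h0, k, hk⟩ := h
  refine ⟨?_, k, ?_⟩
  · rw [Multiset.mem_map]
    rintro ⟨r, hr, hr0⟩
    rw [map_eq_zero] at hr0
    exact h0 (hr0 ▸ hr)
  · rw [Matrix.charpoly_map, hk]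
    simp [Polynomial.map_multiset_prod, Multiset.map_map]

/-- The characteristic polynomial of `c • M` is that of `M` evaluated at `X / c` and scaled by `c`
to the size of `M`. -/
theorem smul {c : F} (hc : c ≠ 0) {M : Matrix n n F} {R : Multiset F}
    (h : HasNonzeroEigenvalues M R) : HasNonzeroEigenvalues (c • M) (R.map (c * ·)) := by
  obtain ⟨h0, k, hk⟩ := h
  have hcc : C c * C c⁻¹ = (1 : F[X]) := by rw [← C_mul, mul_inv_cancel₀ hc, C_1]
  have key : (c • M).charpoly
      = C c ^ Fintype.card n * M.charpoly.comp (C c⁻¹ * X) := by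
    rw [Matrix.charpoly, Matrix.charpoly, ← coe_compRingHom_apply, RingHom.map_det,
      ← Matrix.det_smul]
    congr 1
    ext1 i j
    rcases eq_or_ne i j with rfl | hij
    · simp [Matrix.charmatrix_apply_eq, mul_sub, ← mul_assoc, hcc]
    · simp [Matrix.charmatrix_apply_ne _ _ _ hij]
  have hcard : Fintype.card n = k + R.card := by
    rw [← natDegree_X_pow_mul_prod, ← hk, Matrix.charpoly_natDegree_eq_dim]
  refine ⟨?_, k, ?_⟩
  · simpa [hc] using h0
  · rw [key, hk, hcard, mul_comp, X_pow_comp, multiset_prod_comp, Multiset.map_map,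
      Multiset.map_map, mul_pow, pow_add,
      show ∀ a b d e f : F[X], a * b * (d * e * f) = a * d * e * (b * f) by intros; ring,
      ← mul_pow, hcc, one_pow, one_mul]
    congr 1
    rw [← Multiset.prod_replicate, ← Multiset.map_const', ← Multiset.prod_map_mul]
    congr 1
    refine Multiset.map_congr rfl fun r _ => ?_
    simp [mul_sub, ← mul_assoc, hcc]

/-- If `A * B = 0`, the nonzero spectrum of `c + (A + B)` consists of the shifts by `c` of the
nonzero eigenvalues of `A` and `B`, and copies of `c`. -/
theorem scalar_add {A B : Matrix n n F} {R S : Multiset F} {c : F} (hc : c ≠ 0)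
    (hAB : A * B = 0) (hA : HasNonzeroEigenvalues A R) (hB : HasNonzeroEigenvalues B S)
    (hR : ∀ r ∈ R, c + r ≠ 0) (hS : ∀ r ∈ S, c + r ≠ 0) :
    R.card + S.card ≤ Fintype.card n ∧
    HasNonzeroEigenvalues (Matrix.scalar n c + (A + B))
      (R.map (c + ·) + S.map (c + ·) +
        Multiset.replicate (Fintype.card n - R.card - S.card) c) := by
  obtain ⟨hR0, a, ha⟩ := hA
  obtain ⟨hS0, b, hb⟩ := hB
  have hca : Fintype.card n = a + R.card := by
    rw [← natDegree_X_pow_mul_prod, ← ha, Matrix.charpoly_natDegree_eq_dim]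
  have hcb : Fintype.card n = b + S.card := by
    rw [← natDegree_X_pow_mul_prod, ← hb, Matrix.charpoly_natDegree_eq_dim]
  -- As `A * B = 0`, `(X - A)(X - B) = X (X - (A + B))`; take determinants.
  have hmul : X ^ Fintype.card n * (A + B).charpoly = A.charpoly * B.charpoly := by
    have hAB' : A.map C * B.map C = 0 := by
      rw [← Matrix.map_mul, hAB]; ext; simp
    have : A.charmatrix * B.charmatrix = (X : F[X]) • (A + B).charmatrix := by
      rw [Matrix.charmatrix, Matrix.charmatrix, Matrix.charmatrix]
      simp only [RingHom.mapMatrix_apply]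
      rw [sub_mul, mul_sub, mul_sub, hAB', Matrix.scalar_apply, ← Matrix.smul_eq_diagonal_mul]
      rw [show (A + B).map (C : F →+* F[X]) = A.map C + B.map C from
        Matrix.map_add _ (fun _ _ => C_add) A B]
      refine Matrix.ext fun i j => ?_
      rcases eq_or_ne i j with rfl | hij
      · simp [Matrix.mul_diagonal, Matrix.diagonal_mul]
        ring
      · simp [Matrix.mul_diagonal, Matrix.diagonal_mul, hij]
        ring
    rw [Matrix.charpoly, Matrix.charpoly, Matrix.charpoly, ← Matrix.det_mul, this,
      Matrix.det_smul]
  have h0 : (0 : F) ∉ R + S := by simp [hR0, hS0]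
  have hmul' : X ^ Fintype.card n * (A + B).charpoly
      = X ^ (a + b) * ((R + S).map fun r => X - C r).prod := by
    rw [hmul, ha, hb, Multiset.map_add, Multiset.prod_add]; ring
  obtain ⟨k, hk, hch⟩ := eq_X_pow_mul_of_X_pow_mul_eq h0 hmul'
  -- The exponent of `X` is `0` because every shifted eigenvalue is nonzero; the `k` zeros of `A +
  -- B` become the copies of `c`.
  refine ⟨by omega, ?_, 0, ?_⟩
  · simp only [Multiset.mem_add, Multiset.mem_map, Multiset.mem_replicate]
    rintro ((⟨r, hr, h⟩ | ⟨r, hr, h⟩) | ⟨-, h⟩)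
    · exact hR r hr h
    · exact hS r hr h
    · exact hc h.symm
  · have : Matrix.scalar n c + (A + B) = (A + B) - Matrix.scalar n (-c) := by
      rw [map_neg, sub_neg_eq_add, add_comm]
    rw [this, Matrix.charpoly_sub_scalar, hch, mul_comp, X_pow_comp, multiset_prod_comp,
      show Fintype.card n - R.card - S.card = k by omega]
    simp only [Multiset.map_add, Multiset.prod_add, Multiset.map_map, Multiset.map_replicate,
      Multiset.prod_replicate, Function.comp_def, sub_comp, X_comp, C_comp, pow_zero, one_mul,
      C_neg, ← sub_eq_add_neg, C_add, sub_sub]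
    ring

theorem filter_aroots {E : Type*} [Field E] [Algebra F E] {M : Matrix n n F} {R : Multiset F}
    (h : HasNonzeroEigenvalues M R) :
    nonzeroPart (M.charpoly.aroots E) = R.map (algebraMap F E) := by
  classical
  obtain ⟨h0, k, hk⟩ := h
  have hne : (X ^ k * (R.map fun r => X - C r).prod : F[X]) ≠ 0 :=
    hk ▸ (Matrix.charpoly_monic M).ne_zero
  have hmap : ((R.map fun r => X - C r).prod).map (algebraMap F E)
      = ((R.map (algebraMap F E)).map fun r => X - C r).prod := by
    simp [Polynomial.map_multiset_prod, Multiset.map_map]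
  rw [hk, aroots_mul hne, aroots_X_pow, aroots, hmap, roots_multiset_prod_X_sub_C, nonzeroPart,
    Multiset.filter_add, Multiset.filter_eq_nil.2, Multiset.filter_eq_self.2]
  · exact zero_add _
  · intro r hr
    obtain ⟨s, hs, rfl⟩ := Multiset.mem_map.1 hr
    rw [Ne, map_eq_zero]
    rintro rfl
    exact h0 hs
  · intro r hr
    have := Multiset.mem_of_mem_nsmul hr
    simpa using this

end HasNonzeroEigenvalues

end LinearAlgebra

/-! ### Signed incidence numbers of faces. -/

/-- The coefficient of the face `E` in the simplicial boundary of the face `G`. -/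
def incidence (E G : Finset ℤ) : ℤ := ∑ j ∈ G, if G.erase j = E then sgn j G else 0

section Incidence

theorem exists_of_incidence_ne_zero {E G : Finset ℤ} (h : incidence E G ≠ 0) :
    ∃ j ∈ G, G.erase j = E := by
  obtain ⟨j, hj, hne⟩ := Finset.exists_ne_zero_of_sum_ne_zero h
  exact ⟨j, hj, by by_contra h'; exact hne (if_neg h')⟩

theorem incidence_erase {G : Finset ℤ} {j : ℤ} (hj : j ∈ G) :
    incidence (G.erase j) G = sgn j G := by
  rw [incidence, Finset.sum_eq_single_of_mem j hj, if_pos rfl]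
  intro k hk hkj
  rw [if_neg]
  exact fun h => hkj (Finset.erase_injOn G hk hj h)

/-- Both sums run over the pairs with `G = E ∪ j`, `j ∉ E`; this is why the coboundary is the
transpose of the boundary. -/
theorem sum_sdiff_insert_eq_incidence (E G : Finset ℤ) {R : Type*} [AddCommMonoid R]
    (f : ℤ → R) :
    (∑ j ∈ G \ E, if insert j E = G then f j else 0) =
      ∑ j ∈ G, if G.erase j = E then f j else 0 := by
  rw [← Finset.sum_filter, ← Finset.sum_filter]
  refine Finset.sum_congr ?_ fun _ _ => rfl
  ext j
  simp only [Finset.mem_filter, Finset.mem_sdiff]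
  constructor
  · rintro ⟨⟨hj, hjE⟩, rfl⟩
    exact ⟨hj, Finset.erase_insert hjE⟩
  · rintro ⟨hj, rfl⟩
    exact ⟨⟨hj, Finset.notMem_erase j G⟩, Finset.insert_erase hj⟩

theorem sum_incidence_mul {𝓕 : Finset (Finset ℤ)} {G : Finset ℤ}
    (h𝓕 : ∀ j ∈ G, G.erase j ∈ 𝓕) (f : Finset ℤ → ℤ) :
    ∑ F ∈ 𝓕, f F * incidence F G = ∑ j ∈ G, f (G.erase j) * sgn j G := by
  rw [← Finset.sum_subset (Finset.image_subset_iff.2 h𝓕 : G.image G.erase ⊆ 𝓕),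
    Finset.sum_image (Finset.erase_injOn G)]
  · exact Finset.sum_congr rfl fun j hj => by rw [incidence_erase hj]
  · intro F _ hF
    by_contra h
    obtain ⟨j, hj, rfl⟩ := exists_of_incidence_ne_zero (right_ne_zero_of_mul h)
    exact hF (Finset.mem_image_of_mem _ hj)

/-- Deleting the smaller vertex moves the larger one down by one position, whereas deleting the
larger does not move the smaller. -/
theorem sgn_mul_sgn_erase {G : Finset ℤ} {j k : ℤ} (hj : j ∈ G) (hk : k ∈ G) (hjk : j < k) :
    sgn k (G.erase j) * sgn j G = -(sgn j (G.erase k) * sgn k G) := by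
  have h1 : (G.erase k).filter (· < j) = G.filter (· < j) := by
    ext u; simp only [Finset.mem_filter, Finset.mem_erase]
    constructor
    · rintro ⟨⟨-, h⟩, h'⟩; exact ⟨h, h'⟩
    · rintro ⟨h, h'⟩; exact ⟨⟨by omega, h⟩, h'⟩
  have h2 : ((G.erase j).filter (· < k)).card + 1 = (G.filter (· < k)).card := by
    have : (G.erase j).filter (· < k) = (G.filter (· < k)).erase j := by
      ext u; simp [and_assoc]
    rw [this]
    exact Finset.card_erase_add_one (by simp [hj, hjk])
  rw [sgn, sgn, sgn, sgn, if_pos hj, if_pos hk, if_pos (Finset.mem_erase.2 ⟨hjk.ne', hk⟩),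
    if_pos (Finset.mem_erase.2 ⟨hjk.ne, hj⟩), h1, ← h2, pow_succ]
  ring

/-- The boundary of a boundary vanishes. -/
theorem sum_incidence_mul_incidence {𝓕 : Finset (Finset ℤ)} {G : Finset ℤ}
    (h𝓕 : ∀ j ∈ G, G.erase j ∈ 𝓕) (E : Finset ℤ) :
    ∑ F ∈ 𝓕, incidence E F * incidence F G = 0 := by
  rw [sum_incidence_mul h𝓕]
  -- `f` is antisymmetric, its diagonal vanishing because `sgn` is zero off the face, so its double
  -- sum equals its own negative.
  let f : ℤ → ℤ → ℤ := fun j k =>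
    if (G.erase j).erase k = E then sgn k (G.erase j) * sgn j G else 0
  have hf : ∀ j ∈ G, ∀ k ∈ G, j < k → f j k = -f k j := by
    intro j hj k hk hjk
    simp only [f]
    rw [Finset.erase_right_comm (a := k), sgn_mul_sgn_erase hj hk hjk]
    split_ifs <;> simp
  have hf' : ∀ j ∈ G, ∀ k ∈ G, f j k = -f k j := by
    intro j hj k hk
    rcases lt_trichotomy j k with h | rfl | h
    · exact hf j hj k hk h
    · simp [f, sgn]
    · rw [hf k hk j hj h, neg_neg]
  have h1 : ∑ j ∈ G, incidence E (G.erase j) * sgn j G = ∑ j ∈ G, ∑ k ∈ G, f j k := by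
    refine Finset.sum_congr rfl fun j hj => ?_
    rw [incidence, Finset.sum_mul]
    refine (Finset.sum_congr rfl fun k _ => ?_).trans
      (Finset.sum_subset (Finset.erase_subset j G) fun k _ hk => ?_)
    · simp only [f]; split_ifs <;> simp
    · have : k ∉ G.erase j := hk
      simp only [f, sgn, if_neg this, zero_mul, ite_self]
  have h2 : ∑ j ∈ G, ∑ k ∈ G, f j k = -∑ j ∈ G, ∑ k ∈ G, f j k := by
    conv_lhs => rw [Finset.sum_comm]
    simp only [← Finset.sum_neg_distrib]
    exact Finset.sum_congr rfl fun j hj => Finset.sum_congr rfl fun k hk => hf' k hk j hj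
  rw [h1]
  omega

variable {p : ℤ}

/-- Only deletion of `p` can produce a face without `p`, and its sign is `+1` since `p` is the
smallest vertex. -/
theorem incidence_insert_of_notMem {E F : Finset ℤ} (hE : p ∉ E) (hF : ∀ v ∈ F, p < v) :
    incidence E (insert p F) = if E = F then 1 else 0 := by
  have hp : p ∉ F := fun h => (hF p h).false
  split_ifs with h
  · subst h
    have := incidence_erase (Finset.mem_insert_self p E)
    rw [Finset.erase_insert hp] at this
    rw [this, sgn, if_pos (Finset.mem_insert_self p E), Finset.filter_eq_empty_iff.2]
    · simp
    · intro v hv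
      rcases Finset.mem_insert.1 hv with rfl | hv
      · simp
      · exact (hF v hv).le.not_gt
  · by_contra hne
    obtain ⟨j, hj, rfl⟩ := exists_of_incidence_ne_zero hne
    rcases eq_or_ne j p with rfl | hjp
    · exact h (Finset.erase_insert hp)
    · exact hE (Finset.mem_erase.2 ⟨hjp.symm, Finset.mem_insert_self p F⟩)

/-- A new smallest vertex moves every other vertex one position up, which flips each sign. -/
theorem incidence_insert_insert {E F : Finset ℤ} (hE : p ∉ E) (hF : ∀ v ∈ F, p < v) :
    incidence (insert p E) (insert p F) = -incidence E F := by
  have hp : p ∉ F := fun h => (hF p h).false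
  rw [incidence, incidence, Finset.sum_insert hp, ← Finset.sum_neg_distrib, if_neg, zero_add]
  · refine Finset.sum_congr rfl fun j hj => ?_
    have hjp := (hF j hj).ne
    rw [Finset.erase_insert_of_ne hjp]
    have hiff : insert p (F.erase j) = insert p E ↔ F.erase j = E := by
      constructor
      · intro h
        rw [← Finset.erase_insert hE, ← h, Finset.erase_insert]
        exact fun h' => hp (Finset.mem_of_mem_erase h')
      · rintro rfl; rfl
    have hs : sgn j (insert p F) = -sgn j F := by
      rw [sgn, sgn, if_pos (Finset.mem_insert_of_mem hj), if_pos hj, Finset.filter_insert,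
        if_pos (hF j hj), Finset.card_insert_of_notMem (by simp [hp]), pow_succ]
      ring
    simp only [hiff, hs]
    split_ifs <;> simp
  · intro h
    have : p ∈ (insert p F).erase p := h ▸ Finset.mem_insert_self p E
    simp at this

end Incidence

/-! ### Near-cones: the boundary map factors through the link of the apex. -/

/-- The faces `F` without `p` such that `insert p F` belongs to the family. -/
def linkFamily (p : ℤ) (𝓖 : Finset (Finset ℤ)) : Finset (Finset ℤ) := 𝓖.memberSubfamily p

/-- The members of the family without `p`. -/
def delFamily (p : ℤ) (𝓖 : Finset (Finset ℤ)) : Finset (Finset ℤ) := 𝓖.nonMemberSubfamily p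

/-- A family of sets of integers which are at least `p`, in which each element of a member can be
replaced with `p`. -/
structure IsNearCone (p : ℤ) (𝓖 : Finset (Finset ℤ)) : Prop where
  le : ∀ G ∈ 𝓖, ∀ v ∈ G, p ≤ v
  insert_erase_mem : ∀ G ∈ 𝓖, p ∉ G → ∀ j ∈ G, insert p (G.erase j) ∈ 𝓖

section NearCone

variable {p : ℤ} {𝓖 : Finset (Finset ℤ)}

theorem mem_linkFamily {F : Finset ℤ} : F ∈ linkFamily p 𝓖 ↔ insert p F ∈ 𝓖 ∧ p ∉ F :=
  Finset.mem_memberSubfamily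

theorem mem_delFamily {F : Finset ℤ} : F ∈ delFamily p 𝓖 ↔ F ∈ 𝓖 ∧ p ∉ F :=
  Finset.mem_nonMemberSubfamily

namespace IsNearCone

theorem lt_of_mem_linkFamily (h : IsNearCone p 𝓖) {F : Finset ℤ} (hF : F ∈ linkFamily p 𝓖) :
    ∀ v ∈ F, p < v := by
  rw [mem_linkFamily] at hF
  intro v hv
  exact lt_of_le_of_ne (h.le _ hF.1 v (Finset.mem_insert_of_mem hv)) fun e => hF.2 (e ▸ hv)

theorem lt_of_mem_delFamily (h : IsNearCone p 𝓖) {F : Finset ℤ} (hF : F ∈ delFamily p 𝓖) :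
    ∀ v ∈ F, p < v := by
  rw [mem_delFamily] at hF
  intro v hv
  exact lt_of_le_of_ne (h.le _ hF.1 v hv) fun e => hF.2 (e ▸ hv)

theorem erase_mem_linkFamily (h : IsNearCone p 𝓖) {G : Finset ℤ} (hG : G ∈ delFamily p 𝓖)
    {j : ℤ} (hj : j ∈ G) : G.erase j ∈ linkFamily p 𝓖 := by
  rw [mem_delFamily] at hG
  rw [mem_linkFamily]
  exact ⟨h.insert_erase_mem G hG.1 hG.2 j hj, fun h' => hG.2 (Finset.mem_of_mem_erase h')⟩

theorem shadow_delFamily_subset (h : IsNearCone p 𝓖) : ∂ (delFamily p 𝓖) ⊆ linkFamily p 𝓖 := by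
  intro E hE
  obtain ⟨G, hG, j, hj, rfl⟩ := Finset.mem_shadow_iff.1 hE
  exact h.erase_mem_linkFamily hG hj

theorem linkFamily_subset_shadow : linkFamily p 𝓖 ⊆ ∂ 𝓖 := by
  intro F hF
  rw [mem_linkFamily] at hF
  have := Finset.erase_mem_shadow hF.1 (Finset.mem_insert_self p F)
  rwa [Finset.erase_insert hF.2] at this

theorem mem_linkFamily_of_incidence_ne_zero (h : IsNearCone p 𝓖) {E G : Finset ℤ} (hG : G ∈ 𝓖)
    (hE : p ∉ E) (hne : incidence E G ≠ 0) : E ∈ linkFamily p 𝓖 := by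
  obtain ⟨j, hj, rfl⟩ := exists_of_incidence_ne_zero hne
  by_cases hp : p ∈ G
  · rcases eq_or_ne j p with rfl | hjp
    · rw [mem_linkFamily, Finset.insert_erase hp]
      exact ⟨hG, Finset.notMem_erase _ _⟩
    · exact (hE (Finset.mem_erase.2 ⟨hjp.symm, hp⟩)).elim
  · exact h.erase_mem_linkFamily (mem_delFamily.2 ⟨hG, hp⟩) hj

/-- The boundary map of a near-cone factors through the chains on the link of the apex. -/
theorem sum_incidence_insert_mul (h : IsNearCone p 𝓖) (E : Finset ℤ) {G : Finset ℤ}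
    (hG : G ∈ 𝓖) :
    ∑ F ∈ linkFamily p 𝓖, incidence E (insert p F) * incidence F G = incidence E G := by
  -- If `p ∈ E` and `p ∈ G`, only `F = G \ p` contributes. If `p ∈ E` and `p ∉ G`, the sum is, up to
  -- sign, a coefficient of a double boundary. If `p ∉ E`, the left factor is a Kronecker delta.
  by_cases hE : p ∈ E
  · by_cases hp : p ∈ G
    · have hG' : G.erase p ∈ linkFamily p 𝓖 := by
        rw [mem_linkFamily, Finset.insert_erase hp]
        exact ⟨hG, Finset.notMem_erase _ _⟩
      have hGG := Finset.insert_erase hp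
      rw [Finset.sum_eq_single_of_mem _ hG', hGG]
      · have := incidence_insert_of_notMem (Finset.notMem_erase p G)
          (h.lt_of_mem_linkFamily hG')
        rw [hGG, if_pos rfl] at this
        rw [this, mul_one]
      · intro F hF hne
        have := incidence_insert_of_notMem (mem_linkFamily.1 hF).2
          (h.lt_of_mem_linkFamily hG')
        rw [hGG, if_neg hne] at this
        rw [this, mul_zero]
    · have hGd : G ∈ delFamily p 𝓖 := mem_delFamily.2 ⟨hG, hp⟩
      have h0 : incidence E G = 0 := by
        by_contra hne
        obtain ⟨j, hj, rfl⟩ := exists_of_incidence_ne_zero hne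
        exact hp (Finset.mem_of_mem_erase hE)
      rw [h0]
      have := sum_incidence_mul_incidence (fun j hj => h.erase_mem_linkFamily hGd hj) (E.erase p)
      rw [← neg_eq_zero, ← Finset.sum_neg_distrib] at this
      rw [← this]
      refine Finset.sum_congr rfl fun F hF => ?_
      have := incidence_insert_insert (Finset.notMem_erase p E) (h.lt_of_mem_linkFamily hF)
      rw [Finset.insert_erase hE] at this
      rw [this, neg_mul]
  · have hsum : ∀ F ∈ linkFamily p 𝓖, incidence E (insert p F) * incidence F G =
        if E = F then incidence F G else 0 := by
      intro F hF
      rw [incidence_insert_of_notMem hE (h.lt_of_mem_linkFamily hF)]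
      split_ifs <;> simp
    rw [Finset.sum_congr rfl hsum, Finset.sum_ite_eq]
    split_ifs with hEl
    · rfl
    · by_contra hne
      exact hEl (h.mem_linkFamily_of_incidence_ne_zero hG hE (Ne.symm hne))

end IsNearCone

end NearCone

/-- The matrix of the boundary map from chains on `𝓖` to chains on `𝓔`. -/
def incidenceMatrix (𝓔 𝓖 : Finset (Finset ℤ)) : Matrix 𝓔 𝓖 ℤ := fun E G => incidence E.1 G.1

/-- The rank of the boundary matrix of a near-cone. -/
theorem IsNearCone.finrank_range_incidenceMatrix {p : ℤ} {𝓔 𝓖 : Finset (Finset ℤ)}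
    (h : IsNearCone p 𝓖) (h𝓔 : ∂ 𝓖 ⊆ 𝓔) :
    Module.finrank ℤ (LinearMap.range (incidenceMatrix 𝓔 𝓖).mulVecLin) =
      (linkFamily p 𝓖).card := by
  let P : Matrix 𝓔 (linkFamily p 𝓖) ℤ := fun E F => incidence E.1 (insert p F.1)
  let R : Matrix (linkFamily p 𝓖) 𝓖 ℤ := fun F G => incidence F.1 G.1
  have hPR : incidenceMatrix 𝓔 𝓖 = P * R := by
    ext E G
    rw [Matrix.mul_apply, incidenceMatrix, ← h.sum_incidence_insert_mul E.1 G.2,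
      ← Finset.sum_coe_sort]
  let e : linkFamily p 𝓖 → 𝓖 := fun F => ⟨insert p F.1, (mem_linkFamily.1 F.2).1⟩
  let ι : linkFamily p 𝓖 → 𝓔 := fun F => ⟨F.1, h𝓔 (IsNearCone.linkFamily_subset_shadow F.2)⟩
  have hone : ∀ F F' : linkFamily p 𝓖,
      incidence F.1 (insert p F'.1) = if F = F' then 1 else 0 := by
    intro F F'
    rw [incidence_insert_of_notMem (mem_linkFamily.1 F.2).2 (h.lt_of_mem_linkFamily F'.2)]
    simp only [Subtype.ext_iff]
  -- `P` contains an identity block in the rows indexed by the link, and `R` below one in the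
  -- columns `insert p F`; so the rank of `P * R` is the inner size, even over `ℤ`.
  have hP : Function.Injective P.mulVecLin := by
    have : P.submatrix ι id = 1 := by
      ext F F'
      rw [Matrix.one_apply]
      exact hone F F'
    intro v w hvw
    have h1 : ∀ u, (P.mulVecLin u) ∘ ι = u := by
      intro u
      calc (P.mulVecLin u) ∘ ι = (P.submatrix ι id).mulVec u := rfl
        _ = u := by rw [this, Matrix.one_mulVec]
    rw [← h1 v, ← h1 w, hvw]
  have hR : Function.Surjective R.mulVecLin := by
    have hRS : R * (Matrix.of fun (G : 𝓖) (F : linkFamily p 𝓖) => if G = e F then (1 : ℤ) else 0)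
        = 1 := by
      ext F F'
      rw [Matrix.one_apply, ← hone, Matrix.mul_apply, Finset.sum_eq_single (e F')]
      · rw [Matrix.of_apply, if_pos rfl, mul_one]
      · intro G _ hG
        rw [Matrix.of_apply, if_neg hG, mul_zero]
      · exact fun h' => (h' (Finset.mem_univ _)).elim
    intro v
    refine ⟨(Matrix.of fun (G : 𝓖) (F : linkFamily p 𝓖) => if G = e F then (1 : ℤ) else 0).mulVec
      v, ?_⟩
    rw [Matrix.mulVecLin_apply, Matrix.mulVec_mulVec, hRS, Matrix.one_mulVec]
  rw [hPR, Matrix.mulVecLin_mul, LinearMap.range_comp, LinearMap.range_eq_top.2 hR,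
    Submodule.map_top, LinearMap.finrank_range_of_inj hP]
  simp

/-! ### The raising operator and monomials with a new smallest index. -/

section Raising

variable (K : Type*) [Field K]

theorem raise_algebraMap (f : MvPolynomial (ℤ × ℤ) K) :
    raise K (algebraMap _ (RatFun K) f) =
      algebraMap _ (RatFun K) (MvPolynomial.rename (fun q => (q.1 + 1, q.2)) f) := by
  rw [raise, IsFractionRing.ringEquivOfRingEquiv_algebraMap]
  rfl

theorem raise_x (k v : ℤ) : raise K (x K k v) = x K (k + 1) v := by
  rw [x, raise_algebraMap, MvPolynomial.rename_X, x]

/-- The `a`-th iterate of the raising operator as a ring homomorphism. -/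
noncomputable def raiseHom (a : ℤ) : RatFun K →+* RatFun K :=
  ((raise K ^ a : RingAut (RatFun K)) : RatFun K ≃+* RatFun K).toRingHom

theorem raisePow_eq_raiseHom (a : ℤ) (r : RatFun K) : raisePow K a r = raiseHom K a r := rfl

theorem raisePow_zero (r : RatFun K) : raisePow K 0 r = r := by
  rw [raisePow, zpow_zero]; rfl

theorem raisePow_one (r : RatFun K) : raisePow K 1 r = raise K r := by
  rw [raisePow, zpow_one]

theorem raisePow_add (a b : ℤ) (r : RatFun K) :
    raisePow K (a + b) r = raisePow K a (raisePow K b r) := by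
  rw [raisePow, zpow_add]; rfl

/-- The element `p` sorts to the front and takes `x K 1 p`; every other position goes up by one,
which is the effect of raising. -/
theorem xMon_cons {p : ℤ} {S : Multiset ℤ} (h : ∀ v ∈ S, p ≤ v) :
    xMon K (p ::ₘ S) = x K 1 p * raise K (xMon K S) := by
  rw [xMon, Multiset.sort_cons _ _ _ h, List.mapIdx_cons, List.prod_cons, xMon, map_list_prod]
  congr 2
  exact List.ext_getElem (by simp) (by simp [raise_x])

theorem XMon_cons {p : ℤ} {S : Multiset ℤ} (h : ∀ v ∈ S, p ≤ v) :
    XMon K (p ::ₘ S) = x K 1 p ^ 2 * raise K (XMon K S) := by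
  rw [XMon, xMon_cons K h, mul_pow, ← map_pow, XMon]

end Raising

/-! ### Positivity at the all-ones point. -/

section Positivity

variable {K : Type*} [Field K]

/-- A quotient of polynomials which take positive integer values when all the indeterminates are
one. -/
def IsPositive (f : RatFun K) : Prop :=
  ∃ a b : MvPolynomial (ℤ × ℤ) K, ∃ m n : ℕ, m ≠ 0 ∧ n ≠ 0 ∧
    MvPolynomial.eval 1 a = m ∧ MvPolynomial.eval 1 b = n ∧
    f * algebraMap _ (RatFun K) b = algebraMap _ (RatFun K) a

namespace IsPositive

theorem algebraMap_ne_zero [CharZero K] {a : MvPolynomial (ℤ × ℤ) K} {m : ℕ} (hm : m ≠ 0)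
    (h : MvPolynomial.eval 1 a = m) : algebraMap _ (RatFun K) a ≠ 0 := by
  rw [Ne, FaithfulSMul.algebraMap_eq_zero_iff]
  rintro rfl
  rw [map_zero] at h
  exact hm (by exact_mod_cast h.symm)

/-- Together with closure under sums, products, inverses and raising, this rules out cancellation
when eigenvalues are shifted by `x K 1 p ^ 2`. -/
theorem ne_zero [CharZero K] {f : RatFun K} (h : IsPositive f) : f ≠ 0 := by
  obtain ⟨a, b, m, n, hm, hn, ha, hb, he⟩ := h
  rintro rfl
  rw [zero_mul] at he
  exact algebraMap_ne_zero hm ha he.symm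

theorem add {f g : RatFun K} (hf : IsPositive f) (hg : IsPositive g) : IsPositive (f + g) := by
  obtain ⟨a, b, m, n, hm, hn, ha, hb, he⟩ := hf
  obtain ⟨a', b', m', n', hm', hn', ha', hb', he'⟩ := hg
  refine ⟨a * b' + a' * b, b * b', m * n' + m' * n, n * n', ?_, by positivity, ?_, ?_, ?_⟩
  · positivity
  · simp [ha, hb, ha', hb']
  · simp [hb, hb']
  · simp only [map_add, map_mul, ← he, ← he']; ring

theorem mul {f g : RatFun K} (hf : IsPositive f) (hg : IsPositive g) : IsPositive (f * g) := by
  obtain ⟨a, b, m, n, hm, hn, ha, hb, he⟩ := hf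
  obtain ⟨a', b', m', n', hm', hn', ha', hb', he'⟩ := hg
  refine ⟨a * a', b * b', m * m', n * n', by positivity, by positivity, ?_, ?_, ?_⟩
  · simp [ha, ha']
  · simp [hb, hb']
  · simp only [map_mul, ← he, ← he']; ring

theorem inv [CharZero K] {f : RatFun K} (hf : IsPositive f) : IsPositive f⁻¹ := by
  have h0 := hf.ne_zero
  obtain ⟨a, b, m, n, hm, hn, ha, hb, he⟩ := hf
  exact ⟨b, a, n, m, hn, hm, hb, ha, by rw [← he, inv_mul_cancel_left₀ h0]⟩

theorem one : IsPositive (1 : RatFun K) := ⟨1, 1, 1, 1, by simp⟩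

theorem x (k v : ℤ) : IsPositive (FineShifted.x K k v) :=
  ⟨MvPolynomial.X (k, v), 1, 1, 1, by simp [FineShifted.x]⟩

theorem raise {f : RatFun K} (hf : IsPositive f) : IsPositive (FineShifted.raise K f) := by
  obtain ⟨a, b, m, n, hm, hn, ha, hb, he⟩ := hf
  refine ⟨MvPolynomial.rename (fun q => (q.1 + 1, q.2)) a,
    MvPolynomial.rename (fun q => (q.1 + 1, q.2)) b, m, n, hm, hn, ?_, ?_, ?_⟩
  · rw [MvPolynomial.eval_rename, ← ha]; rfl
  · rw [MvPolynomial.eval_rename, ← hb]; rfl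
  · rw [← raise_algebraMap, ← raise_algebraMap, ← he, map_mul]

theorem pow {f : RatFun K} (hf : IsPositive f) (n : ℕ) : IsPositive (f ^ n) := by
  induction n with
  | zero => rw [pow_zero]; exact one
  | succ n ih => rw [pow_succ]; exact ih.mul hf

theorem xMon (S : Multiset ℤ) : IsPositive (FineShifted.xMon K S) := by
  rw [FineShifted.xMon]
  -- The offset `c` is arbitrary because passing to the tail of the list increases it by one.
  have : ∀ (l : List ℤ) (c : ℤ),
      IsPositive (l.mapIdx fun k v => FineShifted.x K ((k : ℤ) + c) v).prod := by
    intro l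
    induction l with
    | nil => intro c; simpa using one
    | cons v l ih =>
      intro c
      rw [List.mapIdx_cons, List.prod_cons]
      refine (x _ _).mul ?_
      have := ih (c + 1)
      push_cast
      simpa only [add_assoc, add_comm c 1] using this
  exact this _ 1

end IsPositive

theorem xMon_ne_zero [CharZero K] (S : Multiset ℤ) : xMon K S ≠ 0 := (IsPositive.xMon S).ne_zero

theorem XMon_ne_zero [CharZero K] (S : Multiset ℤ) : XMon K S ≠ 0 :=
  pow_ne_zero _ (xMon_ne_zero S)

theorem x_ne_zero [CharZero K] (k v : ℤ) : x K k v ≠ 0 := (IsPositive.x k v).ne_zero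

end Positivity

/-! ### Adjoining a smallest element to a `z`-polynomial. -/

section ZPoly

variable (K : Type*) [Field K]

theorem zPoly_zero_right (S : Multiset ℤ) : zPoly K S 0 = 0 := by simp [zPoly]

/-- The new summand is `X_{S ∪ p} = x_{1,p}² · ↑X_S`, and the denominator cancels `↑X_S`. -/
theorem zPoly_cons_right [CharZero K] {p : ℤ} {S : Multiset ℤ} (hS : ∀ v ∈ S, p ≤ v)
    (T : Multiset ℤ) : zPoly K S (p ::ₘ T) = x K 1 p ^ 2 + zPoly K S T := by
  have h0 : raise K (XMon K S) ≠ 0 := (map_ne_zero _).2 (XMon_ne_zero S)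
  rw [zPoly, zPoly, raisePow_one, Multiset.map_cons, Multiset.sum_cons, XMon_cons K hS, mul_add]
  congr 1
  field_simp

/-- In the terms `j ∈ T` every monomial acquires `p` in front: numerators gain `x_{1,p}²` and a
raise, while the denominator, already raised, gains `x_{2,p}²`. -/
theorem zPoly_cons_cons [CharZero K] {p : ℤ} {S T : Multiset ℤ} (hS : ∀ v ∈ S, p ≤ v)
    (hT : ∀ v ∈ T, p ≤ v) :
    zPoly K (p ::ₘ S) (p ::ₘ T) =
      x K 1 p ^ 2 + x K 1 p ^ 2 / x K 2 p ^ 2 * raise K (zPoly K S T) := by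
  have hpS : ∀ v ∈ p ::ₘ S, p ≤ v := by
    intro v hv
    rcases Multiset.mem_cons.1 hv with rfl | hv
    · exact le_rfl
    · exact hS v hv
  have h0 : raise K (raise K (XMon K S)) ≠ 0 :=
    (map_ne_zero _).2 ((map_ne_zero _).2 (XMon_ne_zero S))
  have h2 := x_ne_zero (K := K) 2 p
  rw [zPoly_cons_right K hpS]
  congr 1
  rw [zPoly, zPoly, raisePow_one, raisePow_one, XMon_cons K hS, map_mul, map_mul, map_pow, raise_x,
    map_inv₀, map_multiset_sum, Multiset.map_map]
  have : T.map (fun j => XMon K (j ::ₘ p ::ₘ S)) =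
      T.map (fun j => x K 1 p ^ 2 * raise K (XMon K (j ::ₘ S))) := by
    refine Multiset.map_congr rfl fun j hj => ?_
    rw [Multiset.cons_swap, XMon_cons]
    intro v hv
    rcases Multiset.mem_cons.1 hv with rfl | hv
    · exact hT v hj
    · exact hS v hv
  rw [this, Multiset.sum_map_mul_left, mul_inv]
  norm_num
  ring

end ZPoly

/-! ### Weighted boundary matrices, with the dimension-dependent raising factored out. -/

section WeightedIncidence

variable (K : Type*) [Field K]

/-- The coefficient of the face `E` in the finely weighted boundary of the face `G`. -/
noncomputable def weightedIncidence (E G : Finset ℤ) : RatFun K :=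
  incidence E G * (xMon K G.val / raise K (xMon K E.val))

/-- The matrix of the finely weighted boundary map from chains on `𝓖` to chains on `𝓔`. -/
noncomputable def weightedMatrix (𝓔 𝓖 : Finset (Finset ℤ)) : Matrix 𝓔 𝓖 (RatFun K) :=
  fun E G => weightedIncidence K E.1 G.1

/-- The finely weighted up-down Laplacian on chains on `𝓔`. -/
noncomputable def weightedLaplacian (𝓔 𝓖 : Finset (Finset ℤ)) : Matrix 𝓔 𝓔 (RatFun K) :=
  weightedMatrix K 𝓔 𝓖 * (weightedMatrix K 𝓔 𝓖).transpose

theorem raisePow_weightedIncidence (a : ℤ) (E G : Finset ℤ) :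
    (∑ j ∈ G, if G.erase j = E then
      (sgn j G : RatFun K) * (raisePow K a (xMon K G.val) / raisePow K (a + 1) (xMon K E.val))
      else 0) = raiseHom K a (weightedIncidence K E G) := by
  rw [weightedIncidence, incidence, map_mul, map_div₀, map_intCast, ← raisePow_one,
    ← raisePow_eq_raiseHom, ← raisePow_eq_raiseHom, ← raisePow_add, Int.cast_sum, Finset.sum_mul]
  refine Finset.sum_congr rfl fun j _ => ?_
  split_ifs <;> simp

theorem algBoundary_eq (C : Finset (Finset ℤ)) (i : ℤ) :
    algBoundary K C i = (weightedMatrix K (facesOfDim C i) (facesOfDim C (i + 1))).map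
      (raiseHom K (dimension C - (i + 1))) := by
  ext E G
  rw [Matrix.map_apply, weightedMatrix, ← raisePow_weightedIncidence, algBoundary]
  refine Finset.sum_congr rfl fun j _ => ?_
  split_ifs with h
  · rw [h]
  · rfl

theorem algCoboundary_eq (C : Finset (Finset ℤ)) (i : ℤ) :
    algCoboundary K C i = (algBoundary K C i).transpose := by
  ext G E
  rw [algBoundary_eq, Matrix.transpose_apply, Matrix.map_apply, weightedMatrix,
    ← raisePow_weightedIncidence, ← sum_sdiff_insert_eq_incidence, algCoboundary,
    show dimension C - (i + 1) + 1 = dimension C - i by ring,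
    show dimension C - (i + 1) = dimension C - i - 1 by ring]

/-- The dimension of the complex enters only through a field automorphism applied entrywise, so
spectra can be computed for bare families of faces and raised at the end. -/
theorem upDownLaplacian_eq (C : Finset (Finset ℤ)) (i : ℤ) :
    upDownLaplacian K C i = (weightedLaplacian K (facesOfDim C i) (facesOfDim C (i + 1))).map
      (raiseHom K (dimension C - (i + 1))) := by
  rw [upDownLaplacian, algCoboundary_eq, algBoundary_eq, ← Matrix.transpose_map, ← Matrix.map_mul,
    weightedLaplacian]

end WeightedIncidence

/-! ### The spectral recurrence for a near-cone. -/

section NearConeSpectrum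

variable {K : Type*} [Field K] {p : ℤ} {𝓔 𝓖 : Finset (Finset ℤ)}

theorem sum_eq_sum_linkFamily_add_sum_delFamily {M : Type*} [AddCommMonoid M]
    (p : ℤ) (𝓖 : Finset (Finset ℤ)) (f : Finset ℤ → M) :
    ∑ G ∈ 𝓖, f G = ∑ F ∈ linkFamily p 𝓖, f (insert p F) + ∑ G ∈ delFamily p 𝓖, f G := by
  rw [← Finset.sum_filter_add_sum_filter_not 𝓖 (p ∈ ·)]
  congr 1
  refine Finset.sum_nbij' (fun G => G.erase p) (fun F => insert p F) ?_ ?_ ?_ ?_ ?_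
  · intro G hG
    rw [Finset.mem_filter] at hG
    rw [mem_linkFamily, Finset.insert_erase hG.2]
    exact ⟨hG.1, Finset.notMem_erase _ _⟩
  · intro F hF
    exact Finset.mem_filter.2 ⟨(mem_linkFamily.1 hF).1, Finset.mem_insert_self p F⟩
  · intro G hG
    exact Finset.insert_erase (Finset.mem_filter.1 hG).2
  · intro F hF
    exact Finset.erase_insert (mem_linkFamily.1 hF).2
  · intro G hG
    rw [Finset.insert_erase (Finset.mem_filter.1 hG).2]

theorem xMon_insert {F : Finset ℤ} (hF : ∀ v ∈ F, p < v) :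
    xMon K (insert p F).val = x K 1 p * raise K (xMon K F.val) := by
  rw [Finset.insert_val_of_notMem fun h => (hF p h).false, xMon_cons]
  exact fun v hv => (hF v hv).le

section CharZero

variable [CharZero K]

theorem weightedIncidence_insert_of_notMem {E F : Finset ℤ} (hE : p ∉ E)
    (hF : ∀ v ∈ F, p < v) :
    weightedIncidence K E (insert p F) = if E = F then x K 1 p else 0 := by
  have h0 : raise K (xMon K F.val) ≠ 0 := (map_ne_zero _).2 (xMon_ne_zero _)
  rw [weightedIncidence, incidence_insert_of_notMem hE hF, xMon_insert hF]
  split_ifs with h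
  · subst h
    rw [Int.cast_one, one_mul, mul_div_assoc, div_self h0, mul_one]
  · simp

/-- The numerator gains `x_{1,p}`, the denominator gains `x_{2,p}` as it carries one extra raise,
and the sign flips. -/
theorem weightedIncidence_insert_insert {E F : Finset ℤ} (hE : ∀ v ∈ E, p < v)
    (hF : ∀ v ∈ F, p < v) :
    weightedIncidence K (insert p E) (insert p F) =
      -(x K 1 p / x K 2 p) * raise K (weightedIncidence K E F) := by
  rw [weightedIncidence, incidence_insert_insert (fun h => (hE p h).false) hF, xMon_insert hF,
    xMon_insert hE, map_mul, raise_x, weightedIncidence, map_mul, map_intCast, map_div₀]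
  push_cast
  rw [mul_div_mul_comm]
  norm_num
  ring

/-- The weighted boundary of a weighted boundary vanishes. -/
theorem sum_raise_weightedIncidence_mul {𝓕 : Finset (Finset ℤ)} {G : Finset ℤ}
    (h𝓕 : ∀ j ∈ G, G.erase j ∈ 𝓕) (E : Finset ℤ) :
    ∑ F ∈ 𝓕, raise K (weightedIncidence K E F) * weightedIncidence K F G = 0 := by
  -- Raising the left factor makes the intermediate weight `↑x_F` cancel, leaving a weight
  -- independent of `F`.
  have h : ∀ F ∈ 𝓕, raise K (weightedIncidence K E F) * weightedIncidence K F G =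
      ((incidence E F * incidence F G : ℤ) : RatFun K) *
        (xMon K G.val / raise K (raise K (xMon K E.val))) := by
    intro F _
    have h0 : raise K (xMon K F.val) ≠ 0 := (map_ne_zero _).2 (xMon_ne_zero _)
    rw [weightedIncidence, weightedIncidence, map_mul, map_intCast, map_div₀]
    push_cast
    field_simp
  rw [Finset.sum_congr rfl h, ← Finset.sum_mul, ← Int.cast_sum,
    sum_incidence_mul_incidence h𝓕, Int.cast_zero, zero_mul]

namespace IsNearCone

theorem sum_weightedIncidence_insert_mul (h : IsNearCone p 𝓖) (E : Finset ℤ) {G : Finset ℤ}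
    (hG : G ∈ 𝓖) :
    ∑ F ∈ linkFamily p 𝓖, weightedIncidence K E (insert p F) * weightedIncidence K F G =
      x K 1 p * weightedIncidence K E G := by
  have h1 : ∀ F ∈ linkFamily p 𝓖,
      weightedIncidence K E (insert p F) * weightedIncidence K F G =
      ((incidence E (insert p F) * incidence F G : ℤ) : RatFun K) *
        (x K 1 p * (xMon K G.val / raise K (xMon K E.val))) := by
    intro F hF
    have h0 : raise K (xMon K F.val) ≠ 0 := (map_ne_zero _).2 (xMon_ne_zero _)
    rw [weightedIncidence, weightedIncidence, xMon_insert (h.lt_of_mem_linkFamily hF)]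
    push_cast
    field_simp
  rw [Finset.sum_congr rfl h1, ← Finset.sum_mul, ← Int.cast_sum,
    h.sum_incidence_insert_mul E hG, weightedIncidence]
  ring

theorem shadow_linkFamily_subset (h : IsNearCone p 𝓖) (h𝓔 : ∂ 𝓖 ⊆ 𝓔) :
    ∂ (linkFamily p 𝓖) ⊆ linkFamily p 𝓔 := by
  intro E hE
  obtain ⟨F, hF, j, hj, rfl⟩ := Finset.mem_shadow_iff.1 hE
  have hF' := mem_linkFamily.1 hF
  rw [mem_linkFamily]
  refine ⟨h𝓔 ?_, fun h' => hF'.2 (Finset.mem_of_mem_erase h')⟩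
  rw [← Finset.erase_insert_of_ne (h.lt_of_mem_linkFamily hF j hj).ne]
  exact Finset.erase_mem_shadow hF'.1 (Finset.mem_insert_of_mem hj)

/-- On link rows, the columns containing the apex form `x K 1 p` times an identity matrix and give
the scalar term; the remaining columns are those of the deletion. -/
theorem weightedLaplacian_linkFamily (h : IsNearCone p 𝓖) :
    weightedLaplacian K (linkFamily p 𝓖) 𝓖 = Matrix.scalar _ (x K 1 p ^ 2) +
      weightedLaplacian K (linkFamily p 𝓖) (delFamily p 𝓖) := by
  ext F F'
  simp only [weightedLaplacian, Matrix.mul_apply, Matrix.add_apply, Matrix.transpose_apply,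
    weightedMatrix, Matrix.scalar_apply, Matrix.diagonal_apply]
  rw [Finset.sum_coe_sort 𝓖 fun G => weightedIncidence K F.1 G * weightedIncidence K F'.1 G,
    Finset.sum_coe_sort (delFamily p 𝓖)
      fun G => weightedIncidence K F.1 G * weightedIncidence K F'.1 G,
    sum_eq_sum_linkFamily_add_sum_delFamily p 𝓖]
  congr 1
  rw [Finset.sum_eq_single_of_mem F.1 F.2]
  · rw [weightedIncidence_insert_of_notMem (mem_linkFamily.1 F.2).2 (h.lt_of_mem_linkFamily F.2),
      weightedIncidence_insert_of_notMem (mem_linkFamily.1 F'.2).2 (h.lt_of_mem_linkFamily F.2),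
      if_pos rfl]
    simp only [Subtype.ext_iff, eq_comm (a := F'.1) (b := F.1)]
    split_ifs <;> ring
  · intro F'' hF'' hne
    rw [weightedIncidence_insert_of_notMem (mem_linkFamily.1 F.2).2
      (h.lt_of_mem_linkFamily hF''), if_neg hne.symm, zero_mul]

/-- The columns of the weighted boundary matrix which belong to faces containing the apex. -/
theorem transpose_mul_apex_columns (h : IsNearCone p 𝓖) (h𝓔 : ∂ 𝓖 ⊆ 𝓔)
    (h𝓔p : ∀ E ∈ 𝓔, ∀ v ∈ E, p ≤ v) :
    (Matrix.of fun (E : 𝓔) (F : linkFamily p 𝓖) =>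
        weightedIncidence K E.1 (insert p F.1)).transpose *
      (Matrix.of fun (E : 𝓔) (F : linkFamily p 𝓖) => weightedIncidence K E.1 (insert p F.1)) =
    Matrix.scalar _ (x K 1 p ^ 2) + (x K 1 p ^ 2 / x K 2 p ^ 2) •
      ((weightedMatrix K (linkFamily p 𝓔) (linkFamily p 𝓖)).transpose *
        weightedMatrix K (linkFamily p 𝓔) (linkFamily p 𝓖)).map (raise K) := by
  ext F F'
  simp only [Matrix.mul_apply, Matrix.add_apply, Matrix.transpose_apply, Matrix.of_apply,
    Matrix.smul_apply, Matrix.map_apply, weightedMatrix, Matrix.scalar_apply,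
    Matrix.diagonal_apply]
  rw [Finset.sum_coe_sort 𝓔 fun E => weightedIncidence K E (insert p F.1) *
      weightedIncidence K E (insert p F'.1),
    Finset.sum_coe_sort (linkFamily p 𝓔)
      fun E => weightedIncidence K E F.1 * weightedIncidence K E F'.1,
    sum_eq_sum_linkFamily_add_sum_delFamily p 𝓔, add_comm]
  congr 1
  -- Rows without the apex give the scalar block; rows with it, treated next, give the raised
  -- boundary of the link, the two signs cancelling.
  · have hF : F.1 ∈ delFamily p 𝓔 :=
      mem_delFamily.2 ⟨h𝓔 (linkFamily_subset_shadow F.2), (mem_linkFamily.1 F.2).2⟩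
    rw [Finset.sum_eq_single_of_mem F.1 hF]
    · rw [weightedIncidence_insert_of_notMem (mem_linkFamily.1 F.2).2
          (h.lt_of_mem_linkFamily F.2),
        weightedIncidence_insert_of_notMem (mem_linkFamily.1 F.2).2
          (h.lt_of_mem_linkFamily F'.2), if_pos rfl]
      simp only [Subtype.ext_iff]
      split_ifs <;> ring
    · intro E hE hne
      rw [weightedIncidence_insert_of_notMem (mem_delFamily.1 hE).2
        (h.lt_of_mem_linkFamily F.2), if_neg hne, zero_mul]
  · rw [map_sum, smul_eq_mul, Finset.mul_sum]
    refine Finset.sum_congr rfl fun E hE => ?_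
    have hE' : ∀ v ∈ E, p < v := fun v hv =>
      lt_of_le_of_ne (h𝓔p _ (mem_linkFamily.1 hE).1 v (Finset.mem_insert_of_mem hv))
        fun e => (mem_linkFamily.1 hE).2 (e ▸ hv)
    rw [weightedIncidence_insert_insert hE' (h.lt_of_mem_linkFamily F.2),
      weightedIncidence_insert_insert hE' (h.lt_of_mem_linkFamily F'.2), map_mul]
    ring

/-- The recurrence for the nonzero spectrum of the weighted Laplacian of a near-cone. -/
theorem hasNonzeroEigenvalues (h : IsNearCone p 𝓖) (h𝓔 : ∂ 𝓖 ⊆ 𝓔)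
    (h𝓔p : ∀ E ∈ 𝓔, ∀ v ∈ E, p ≤ v) {R S : Multiset (RatFun K)}
    (hR : ∀ r ∈ R, IsPositive r) (hS : ∀ r ∈ S, IsPositive r)
    (hdel : HasNonzeroEigenvalues (weightedLaplacian K (linkFamily p 𝓖) (delFamily p 𝓖)) R)
    (hlink : HasNonzeroEigenvalues (weightedLaplacian K (linkFamily p 𝓔) (linkFamily p 𝓖)) S) :
    R.card + S.card ≤ (linkFamily p 𝓖).card ∧
    HasNonzeroEigenvalues (weightedLaplacian K 𝓔 𝓖)
      (R.map (x K 1 p ^ 2 + ·) +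
        S.map (fun r => x K 1 p ^ 2 + x K 1 p ^ 2 / x K 2 p ^ 2 * raise K r) +
        Multiset.replicate ((linkFamily p 𝓖).card - R.card - S.card) (x K 1 p ^ 2)) := by
  have hc : IsPositive (x K 1 p ^ 2) := (IsPositive.x 1 p).pow 2
  have hq : IsPositive (x K 1 p ^ 2 / x K 2 p ^ 2) := by
    rw [div_eq_mul_inv]; exact hc.mul ((IsPositive.x 2 p).pow 2).inv
  set c := x K 1 p with hcdef
  set q := x K 1 p ^ 2 / x K 2 p ^ 2 with hqdef
  set WB := weightedMatrix K (linkFamily p 𝓔) (linkFamily p 𝓖) with hWB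
  set A := weightedLaplacian K (linkFamily p 𝓖) (delFamily p 𝓖) with hA
  have hS' : HasNonzeroEigenvalues (q • (WB.transpose * WB).map (raise K))
      (S.map fun r => q * raise K r) := by
    -- The link Laplacian lives on `linkFamily p 𝓔`; reversing the product moves it to `linkFamily p
    -- 𝓖`, where `A` acts.
    have := (hlink.mul_comm.map (raise K : RatFun K →+* RatFun K)).smul hq.ne_zero
    rwa [Multiset.map_map] at this
  have hpos : ∀ r ∈ S.map (fun r => q * raise K r), IsPositive r := by
    intro r hr
    obtain ⟨s, hs, rfl⟩ := Multiset.mem_map.1 hr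
    exact hq.mul (hS s hs).raise
  -- The adjacent inner factors are the transpose of a raised link boundary following a deletion
  -- boundary, which is zero.
  have hAQ : A * (q • (WB.transpose * WB).map (raise K)) = 0 := by
    have h0 : (WB.map (raise K)) * weightedMatrix K (linkFamily p 𝓖) (delFamily p 𝓖) = 0 := by
      ext E G
      have := sum_raise_weightedIncidence_mul (K := K)
        (fun j hj => h.erase_mem_linkFamily G.2 hj) E.1
      rw [← Finset.sum_coe_sort] at this
      exact this
    have h1 : (WB.transpose * WB).map (raise K) =
        (WB.map (raise K)).transpose * WB.map (raise K) := by
      have := Matrix.map_mul (L := WB.transpose) (M := WB)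
        (f := (raise K : RatFun K →+* RatFun K))
      exact this
    rw [hA, weightedLaplacian, h1, Matrix.mul_smul, ← Matrix.mul_assoc, Matrix.mul_assoc _ _
      (Matrix.transpose _), ← Matrix.transpose_mul, h0]
    simp
  have key := HasNonzeroEigenvalues.scalar_add hc.ne_zero hAQ hdel hS'
    (fun r hr => (hc.add (hR r hr)).ne_zero) (fun r hr => (hc.add (hpos r hr)).ne_zero)
  rw [Fintype.card_coe, Multiset.card_map, Multiset.map_map] at key
  refine ⟨key.1, ?_⟩
  have hcc : (c ^ 2)⁻¹ * c ^ 2 = 1 := inv_mul_cancel₀ hc.ne_zero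
  have hc0 : c ≠ 0 := (IsPositive.x 1 p).ne_zero
  set P : Matrix 𝓔 (linkFamily p 𝓖) (RatFun K) :=
    Matrix.of fun E F => weightedIncidence K E.1 (insert p F.1) with hP
  set T := weightedMatrix K (linkFamily p 𝓖) 𝓖 with hT
  have hfac : weightedMatrix K 𝓔 𝓖 = c⁻¹ • (P * T) := by
    ext E G
    rw [Matrix.smul_apply, Matrix.mul_apply, smul_eq_mul]
    have := h.sum_weightedIncidence_insert_mul (K := K) E.1 G.2
    rw [← Finset.sum_coe_sort] at this
    rw [eq_inv_mul_iff_mul_eq₀ hc0]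
    exact this.symm
  have hPP := h.transpose_mul_apex_columns (K := K) h𝓔 h𝓔p
  have hTT := h.weightedLaplacian_linkFamily (K := K)
  rw [weightedLaplacian] at hTT
  -- This is `c⁻² (c² + A)(c² + B) = c² + A + B`, with `B` the rescaled raised link term and `A * B
  -- = 0`.
  have hmain : (T * T.transpose * P.transpose) * ((c ^ 2)⁻¹ • P) =
      Matrix.scalar _ (c ^ 2) + (A + q • (WB.transpose * WB).map (raise K)) := by
    rw [Matrix.mul_smul, Matrix.mul_assoc, hPP, hTT, add_mul, mul_add A, hAQ, add_zero, mul_add,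
      ← Matrix.scalar_comm (c ^ 2) (fun r => mul_comm _ _) A, ← mul_add, ← mul_add,
      Matrix.scalar_apply, ← Matrix.smul_eq_diagonal_mul, smul_smul, hcc, one_smul]
    abel
  have hlap : weightedLaplacian K 𝓔 𝓖 =
      ((c ^ 2)⁻¹ • P) * (T * T.transpose * P.transpose) := by
    rw [weightedLaplacian, hfac, Matrix.transpose_smul, Matrix.transpose_mul, Matrix.smul_mul,
      Matrix.mul_smul, smul_smul, Matrix.smul_mul, ← mul_inv, ← pow_two]
    simp only [Matrix.mul_assoc]
  rw [hlap]
  refine HasNonzeroEigenvalues.mul_comm ?_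
  rw [hmain]
  exact key.2

end IsNearCone

end CharZero

end NearConeSpectrum

/-! ### Shifted families and induction on the interval. -/

/-- A shifted family of subsets of the interval `[a, b]`. -/
structure IsShiftedFamily (𝓖 : Finset (Finset ℤ)) (a b : ℤ) : Prop where
  subset_interval : ∀ F ∈ 𝓖, F ⊆ Finset.Icc a b
  exchange : ∀ F ∈ 𝓖, ∀ i j : ℤ, a ≤ i → i < j → i ∉ F → j ∈ F → insert i (F.erase j) ∈ 𝓖

namespace IsShiftedFamily

variable {𝓖 : Finset (Finset ℤ)} {a b : ℤ}

theorem isNearCone (h : IsShiftedFamily 𝓖 a b) : IsNearCone a 𝓖 where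
  le G hG v hv := (Finset.mem_Icc.1 (h.subset_interval G hG hv)).1
  insert_erase_mem G hG haG j hj := by
    refine h.exchange G hG a j le_rfl ?_ haG hj
    exact lt_of_le_of_ne (Finset.mem_Icc.1 (h.subset_interval G hG hj)).1 fun e => haG (e ▸ hj)

theorem delFamily (h : IsShiftedFamily 𝓖 a b) : IsShiftedFamily (delFamily a 𝓖) (a + 1) b where
  subset_interval F hF v hv := by
    have h1 := h.isNearCone.lt_of_mem_delFamily hF v hv
    have h2 := Finset.mem_Icc.1 (h.subset_interval F (mem_delFamily.1 hF).1 hv)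
    exact Finset.mem_Icc.2 ⟨h1, h2.2⟩
  exchange F hF i j hi hij hiF hj := by
    rw [mem_delFamily] at hF ⊢
    refine ⟨h.exchange F hF.1 i j (by omega) hij hiF hj, ?_⟩
    simp only [Finset.mem_insert, Finset.mem_erase, not_or, not_and]
    exact ⟨by omega, fun _ => hF.2⟩

theorem linkFamily (h : IsShiftedFamily 𝓖 a b) : IsShiftedFamily (linkFamily a 𝓖) (a + 1) b where
  subset_interval F hF v hv := by
    have h1 := h.isNearCone.lt_of_mem_linkFamily hF v hv
    have h2 := Finset.mem_Icc.1
      (h.subset_interval _ (mem_linkFamily.1 hF).1 (Finset.mem_insert_of_mem hv))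
    exact Finset.mem_Icc.2 ⟨h1, h2.2⟩
  exchange F hF i j hi hij hiF hj := by
    have hj' := h.isNearCone.lt_of_mem_linkFamily hF j hj
    rw [mem_linkFamily] at hF ⊢
    constructor
    · have := h.exchange _ hF.1 i j (by omega) hij
        (by simp only [Finset.mem_insert, not_or]; exact ⟨by omega, hiF⟩)
        (Finset.mem_insert_of_mem hj)
      rwa [Finset.erase_insert_of_ne hj'.ne, Finset.insert_comm] at this
    · simp only [Finset.mem_insert, Finset.mem_erase, not_or, not_and]
      exact ⟨by omega, fun _ => hF.2⟩

end IsShiftedFamily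

/-- `R` is the nonzero spectrum of the weighted Laplacian of `𝓖`; it consists of `z`-polynomials
and its cardinality is the rank of the boundary map. -/
structure IsZSpectrum (K : Type*) [Field K] (𝓖 : Finset (Finset ℤ)) (a : ℤ)
    (R : Multiset (RatFun K)) : Prop where
  isPositive : ∀ r ∈ R, IsPositive r
  exists_zPoly : ∀ r ∈ R, ∃ S T : Finset ℤ, S ⊆ 𝓖.sup id ∧ T ⊆ 𝓖.sup id ∧
    r = zPoly K S.val T.val
  hasNonzeroEigenvalues : ∀ 𝓔, ∂ 𝓖 ⊆ 𝓔 → (∀ E ∈ 𝓔, ∀ v ∈ E, a ≤ v) →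
    HasNonzeroEigenvalues (weightedLaplacian K 𝓔 𝓖) R
  finrank_range : ∀ 𝓔, ∂ 𝓖 ⊆ 𝓔 →
    Module.finrank ℤ (LinearMap.range (incidenceMatrix 𝓔 𝓖).mulVecLin) = R.card

section Recurrence

variable (K : Type*) [Field K] [CharZero K] {𝓖 : Finset (Finset ℤ)} {a b : ℤ}

theorem zPoly_insert_right {p : ℤ} {S T : Finset ℤ} (hS : ∀ v ∈ S, p < v)
    (hT : ∀ v ∈ T, p < v) :
    zPoly K S.val (insert p T).val = x K 1 p ^ 2 + zPoly K S.val T.val := by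
  rw [Finset.insert_val_of_notMem fun h => (hT p h).false,
    zPoly_cons_right K fun v hv => (hS v hv).le]

theorem zPoly_insert_insert {p : ℤ} {S T : Finset ℤ} (hS : ∀ v ∈ S, p < v)
    (hT : ∀ v ∈ T, p < v) :
    zPoly K (insert p S).val (insert p T).val =
      x K 1 p ^ 2 + x K 1 p ^ 2 / x K 2 p ^ 2 * raise K (zPoly K S.val T.val) := by
  rw [Finset.insert_val_of_notMem fun h => (hT p h).false,
    Finset.insert_val_of_notMem fun h => (hS p h).false,
    zPoly_cons_cons K (fun v hv => (hS v hv).le) fun v hv => (hT v hv).le]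

theorem zPoly_empty_singleton (p : ℤ) :
    zPoly K (∅ : Finset ℤ).val ({p} : Finset ℤ).val = x K 1 p ^ 2 := by
  have := zPoly_insert_right K (p := p) (S := ∅) (T := ∅) (by simp) (by simp)
  rw [show ({p} : Finset ℤ) = insert p ∅ from rfl, this, Finset.empty_val, zPoly_zero_right,
    add_zero]

/-- The recurrence for the nonzero spectrum of a shifted family. -/
theorem IsZSpectrum.recurrence {K : Type*} [Field K] [CharZero K] (h : IsShiftedFamily 𝓖 a b)
    {R S : Multiset (RatFun K)} (hR : IsZSpectrum K (delFamily a 𝓖) (a + 1) R)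
    (hS : IsZSpectrum K (linkFamily a 𝓖) (a + 1) S) :
    R.card + S.card ≤ (linkFamily a 𝓖).card ∧
    IsZSpectrum K 𝓖 a (R.map (x K 1 a ^ 2 + ·) +
        S.map (fun r => x K 1 a ^ 2 + x K 1 a ^ 2 / x K 2 a ^ 2 * raise K r) +
        Multiset.replicate ((linkFamily a 𝓖).card - R.card - S.card) (x K 1 a ^ 2)) := by
  have hcone := h.isNearCone
  -- The row family must be arbitrary in `IsZSpectrum`: the deletion is used with rows `linkFamily a
  -- 𝓖`, the link with rows `linkFamily a 𝓔`.
  have hrec : ∀ 𝓔, ∂ 𝓖 ⊆ 𝓔 → (∀ E ∈ 𝓔, ∀ v ∈ E, a ≤ v) → _ := fun 𝓔 h𝓔 h𝓔a =>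
    hcone.hasNonzeroEigenvalues h𝓔 h𝓔a hR.isPositive hS.isPositive
      (hR.hasNonzeroEigenvalues _ hcone.shadow_delFamily_subset
        fun E hE v hv => hcone.lt_of_mem_linkFamily hE v hv)
      (hS.hasNonzeroEigenvalues _ (hcone.shadow_linkFamily_subset h𝓔) fun E hE v hv =>
        lt_of_le_of_ne (h𝓔a _ (mem_linkFamily.1 hE).1 v (Finset.mem_insert_of_mem hv))
          fun e => (mem_linkFamily.1 hE).2 (e ▸ hv))
  have hle : R.card + S.card ≤ (linkFamily a 𝓖).card := by
    refine (hrec (∂ 𝓖) subset_rfl fun E hE v hv => ?_).1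
    obtain ⟨G, hG, j, -, rfl⟩ := Finset.mem_shadow_iff.1 hE
    exact hcone.le G hG v (Finset.mem_of_mem_erase hv)
  have hc : IsPositive (x K 1 a ^ 2) := (IsPositive.x 1 a).pow 2
  have hq : IsPositive (x K 1 a ^ 2 / x K 2 a ^ 2) := by
    rw [div_eq_mul_inv]; exact hc.mul ((IsPositive.x 2 a).pow 2).inv
  -- The truncated subtraction is exact by `hle`; the total is the integral rank of the boundary map
  -- of a near-cone.
  have hcard : (R.map (x K 1 a ^ 2 + ·) +
        S.map (fun r => x K 1 a ^ 2 + x K 1 a ^ 2 / x K 2 a ^ 2 * raise K r) +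
        Multiset.replicate ((linkFamily a 𝓖).card - R.card - S.card) (x K 1 a ^ 2)).card =
      (linkFamily a 𝓖).card := by
    simp only [Multiset.card_add, Multiset.card_map, Multiset.card_replicate]
    omega
  refine ⟨hle, ?_, ?_, fun 𝓔 h𝓔 h𝓔a => (hrec 𝓔 h𝓔 h𝓔a).2, fun 𝓔 h𝓔 => ?_⟩
  · simp only [Multiset.mem_add, Multiset.mem_map, Multiset.mem_replicate]
    rintro _ ((⟨r, hr, rfl⟩ | ⟨r, hr, rfl⟩) | ⟨-, rfl⟩)
    · exact hc.add (hR.isPositive r hr)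
    · exact hc.add (hq.mul (hS.isPositive r hr).raise)
    · exact hc
  · intro r hr
    -- The left end `a` need not be a vertex in general, but one nonzero eigenvalue forces the link
    -- family to be nonempty.
    have ha : a ∈ 𝓖.sup id := by
      have hpos := Multiset.card_pos_iff_exists_mem.2 ⟨r, hr⟩
      rw [hcard] at hpos
      obtain ⟨F, hF⟩ := Finset.card_pos.1 hpos
      exact Finset.mem_sup.2 ⟨_, (mem_linkFamily.1 hF).1, Finset.mem_insert_self a F⟩
    have hdel : ∀ v ∈ (delFamily a 𝓖).sup id, a < v ∧ v ∈ 𝓖.sup id := by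
      intro v hv
      obtain ⟨G, hG, hvG⟩ := Finset.mem_sup.1 hv
      exact ⟨hcone.lt_of_mem_delFamily hG v hvG,
        Finset.mem_sup.2 ⟨G, (mem_delFamily.1 hG).1, hvG⟩⟩
    have hlink : ∀ v ∈ (linkFamily a 𝓖).sup id, a < v ∧ v ∈ 𝓖.sup id := by
      intro v hv
      obtain ⟨G, hG, hvG⟩ := Finset.mem_sup.1 hv
      exact ⟨hcone.lt_of_mem_linkFamily hG v hvG,
        Finset.mem_sup.2 ⟨_, (mem_linkFamily.1 hG).1, Finset.mem_insert_of_mem hvG⟩⟩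
    simp only [Multiset.mem_add, Multiset.mem_map, Multiset.mem_replicate] at hr
    rcases hr with (⟨r, hr, rfl⟩ | ⟨r, hr, rfl⟩) | ⟨-, rfl⟩
    · obtain ⟨S, T, hS, hT, rfl⟩ := hR.exists_zPoly r hr
      exact ⟨S, insert a T, fun v hv => (hdel v (hS hv)).2,
        Finset.insert_subset ha fun v hv => (hdel v (hT hv)).2,
        (zPoly_insert_right K (fun v hv => (hdel v (hS hv)).1)
          fun v hv => (hdel v (hT hv)).1).symm⟩
    · obtain ⟨S, T, hS, hT, rfl⟩ := hS.exists_zPoly r hr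
      exact ⟨insert a S, insert a T, Finset.insert_subset ha fun v hv => (hlink v (hS hv)).2,
        Finset.insert_subset ha fun v hv => (hlink v (hT hv)).2,
        (zPoly_insert_insert K (fun v hv => (hlink v (hS hv)).1)
          fun v hv => (hlink v (hT hv)).1).symm⟩
    · exact ⟨∅, {a}, Finset.empty_subset _, Finset.singleton_subset_iff.2 ha,
        (zPoly_empty_singleton K a).symm⟩
  · rw [hcone.finrank_range_incidenceMatrix h𝓔, hcard]

/-- The nonzero spectrum of a shifted family consists of `z`-polynomials. -/
theorem IsShiftedFamily.exists_isZSpectrum (h : IsShiftedFamily 𝓖 a b) :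
    ∃ R, IsZSpectrum K 𝓖 a R := by
  induction hN : (b + 1 - a).toNat generalizing a 𝓖 with
  | zero =>
    -- On an empty interval the only possible member is `∅`, whose boundary is zero.
    have hinc : ∀ E : Finset ℤ, ∀ G ∈ 𝓖, incidence E G = 0 := by
      intro E G hG
      have : G = ∅ := by
        rw [← Finset.subset_empty, ← Finset.Icc_eq_empty (show ¬ a ≤ b by omega)]
        exact h.subset_interval G hG
      simp [this, incidence]
    refine ⟨0, by simp, by simp, fun 𝓔 _ _ => ?_, fun 𝓔 _ => ?_⟩
    · have : weightedMatrix K 𝓔 𝓖 = 0 := by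
        ext E G
        simp [weightedMatrix, weightedIncidence, hinc _ _ G.2]
      rw [weightedLaplacian, this, Matrix.zero_mul]
      exact HasNonzeroEigenvalues.zero
    · have : incidenceMatrix 𝓔 𝓖 = 0 := by
        ext E G
        exact hinc _ _ G.2
      rw [this, Matrix.mulVecLin_zero, LinearMap.range_zero, finrank_bot, Multiset.card_zero]
  | succ N ih =>
    obtain ⟨R, hR⟩ := ih h.delFamily (by omega)
    obtain ⟨S, hS⟩ := ih h.linkFamily (by omega)
    exact ⟨_, (IsZSpectrum.recurrence h hR hS).2⟩

end Recurrence

/-! ### Faces of skeleton, deletion and link; Betti numbers. -/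

section Complexes

variable {C : Finset (Finset ℤ)} {a b i p : ℤ}

theorem mem_facesOfDim {F : Finset ℤ} : F ∈ facesOfDim C i ↔ F ∈ C ∧ (F.card : ℤ) = i + 1 :=
  Finset.mem_filter

theorem facesOfDim_subset : facesOfDim C i ⊆ C := Finset.filter_subset _ _

theorem FineShifted.IsSimplicialComplex.shadow_facesOfDim_subset (hC : IsSimplicialComplex C)
    (i : ℤ) : ∂ (facesOfDim C (i + 1)) ⊆ facesOfDim C i := by
  intro E hE
  obtain ⟨G, hG, j, hj, rfl⟩ := Finset.mem_shadow_iff.1 hE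
  rw [mem_facesOfDim] at hG ⊢
  refine ⟨hC.down_closed G hG.1 _ (Finset.erase_subset j G), ?_⟩
  have := Finset.card_erase_add_one hj
  omega

theorem FineShifted.IsSimplicialComplex.sup_facesOfDim_subset (hC : IsSimplicialComplex C)
    {S : Finset ℤ} (hS : S ⊆ (facesOfDim C i).sup id) : (S : Set ℤ) ⊆ vertices C := by
  intro v hv
  obtain ⟨F, hF, hvF⟩ := Finset.mem_sup.1 (hS hv)
  exact hC.down_closed F (facesOfDim_subset hF) _ (Finset.singleton_subset_iff.2 hvF)

theorem FineShifted.IsShiftedComplex.isShiftedFamily (hC : IsShiftedComplex C a b) (i : ℤ) :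
    IsShiftedFamily (facesOfDim C i) a b where
  subset_interval F hF := hC.subset_interval F (facesOfDim_subset hF)
  exchange F hF k j hk hkj hkF hj := by
    rw [mem_facesOfDim] at hF ⊢
    refine ⟨hC.exchange F hF.1 k j hk hkj hkF hj, ?_⟩
    rw [Finset.card_insert_of_notMem fun h => hkF (Finset.mem_of_mem_erase h),
      Finset.card_erase_add_one hj, hF.2]

theorem dimension_eq (h : (facesOfDim C i).Nonempty) (hle : ∀ F ∈ C, (F.card : ℤ) ≤ i + 1) :
    dimension C = i := by
  obtain ⟨F, hF⟩ := h
  rw [mem_facesOfDim] at hF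
  have h1 : F.card ≤ C.sup Finset.card := Finset.le_sup hF.1
  have h2 : C.sup Finset.card ≤ F.card := Finset.sup_le fun G hG => by
    have := hle G hG
    omega
  rw [dimension]
  omega

theorem FineShifted.IsSimplicialComplex.facesOfDim_nonempty (hC : IsSimplicialComplex C)
    (h0 : 0 ≤ i) (hi : i ≤ dimension C) : (facesOfDim C i).Nonempty := by
  obtain ⟨F, hF, hFc⟩ := Finset.exists_mem_eq_sup C ⟨∅, hC.empty_mem⟩ Finset.card
  rw [dimension, hFc] at hi
  obtain ⟨G, hGF, hG⟩ := Finset.exists_subset_card_eq (show (i + 1).toNat ≤ F.card by omega)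
  exact ⟨G, mem_facesOfDim.2 ⟨hC.down_closed F hF G hGF, by omega⟩⟩

theorem mem_pureSkeleton {F : Finset ℤ} :
    F ∈ pureSkeleton C i ↔ F ∈ C ∧ ∃ G ∈ facesOfDim C i, F ⊆ G :=
  Finset.mem_filter

theorem facesOfDim_pureSkeleton : facesOfDim (pureSkeleton C i) i = facesOfDim C i := by
  ext F
  rw [mem_facesOfDim, mem_pureSkeleton]
  constructor
  · rintro ⟨⟨hF, -⟩, hc⟩
    exact mem_facesOfDim.2 ⟨hF, hc⟩
  · intro hF
    exact ⟨⟨facesOfDim_subset hF, F, hF, subset_rfl⟩, (mem_facesOfDim.1 hF).2⟩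

theorem card_le_of_mem_pureSkeleton {F : Finset ℤ} (hF : F ∈ pureSkeleton C i) :
    (F.card : ℤ) ≤ i + 1 := by
  obtain ⟨-, G, hG, hFG⟩ := mem_pureSkeleton.1 hF
  rw [← (mem_facesOfDim.1 hG).2]
  exact_mod_cast Finset.card_le_card hFG

theorem FineShifted.IsSimplicialComplex.pureSkeleton (hC : IsSimplicialComplex C)
    (h : (facesOfDim C i).Nonempty) : IsSimplicialComplex (pureSkeleton C i) where
  empty_mem := by
    obtain ⟨G, hG⟩ := h
    exact mem_pureSkeleton.2 ⟨hC.empty_mem, G, hG, Finset.empty_subset G⟩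
  down_closed F hF G hGF := by
    obtain ⟨hFC, H, hH, hFH⟩ := mem_pureSkeleton.1 hF
    exact mem_pureSkeleton.2 ⟨hC.down_closed F hFC G hGF, H, hH, hGF.trans hFH⟩

theorem FineShifted.IsSimplicialComplex.mem_deletion (hC : IsSimplicialComplex C)
    {F : Finset ℤ} : F ∈ deletion C p ↔ F ∈ C ∧ p ∉ F := by
  rw [deletion, Finset.mem_image]
  constructor
  · rintro ⟨G, hG, rfl⟩
    exact ⟨hC.down_closed G hG _ (Finset.erase_subset p G), Finset.notMem_erase p G⟩
  · rintro ⟨hF, hp⟩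
    exact ⟨F, hF, Finset.erase_eq_of_notMem hp⟩

theorem FineShifted.IsSimplicialComplex.deletion (hC : IsSimplicialComplex C) (p : ℤ) :
    IsSimplicialComplex (deletion C p) where
  empty_mem := hC.mem_deletion.2 ⟨hC.empty_mem, Finset.notMem_empty p⟩
  down_closed F hF G hGF := by
    rw [hC.mem_deletion] at hF ⊢
    exact ⟨hC.down_closed F hF.1 G hGF, fun h => hF.2 (hGF h)⟩

theorem mem_link {F : Finset ℤ} : F ∈ link C p ↔ F ∈ C ∧ p ∉ F ∧ insert p F ∈ C :=
  Finset.mem_filter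

theorem FineShifted.IsSimplicialComplex.link (hC : IsSimplicialComplex C) (hp : p ∈ vertices C) :
    IsSimplicialComplex (link C p) where
  empty_mem := mem_link.2 ⟨hC.empty_mem, Finset.notMem_empty p, hp⟩
  down_closed F hF G hGF := by
    rw [mem_link] at hF ⊢
    exact ⟨hC.down_closed F hF.1 G hGF, fun h => hF.2.1 (hGF h),
      hC.down_closed _ hF.2.2 _ (Finset.insert_subset_insert p hGF)⟩

theorem FineShifted.IsShiftedComplex.isLeast_vertices_pureSkeleton (hC : IsShiftedComplex C a b)
    (h0 : 0 ≤ i) (h : (facesOfDim C i).Nonempty) :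
    IsLeast (vertices (FineShifted.pureSkeleton C i)) a := by
  constructor
  · have : ∃ G ∈ facesOfDim C i, a ∈ G := by
      obtain ⟨G, hG⟩ := h
      by_cases haG : a ∈ G
      · exact ⟨G, hG, haG⟩
      · have hc := (mem_facesOfDim.1 hG).2
        obtain ⟨j, hj⟩ := Finset.card_pos.1 (show 0 < G.card by omega)
        exact ⟨_, (hC.isShiftedFamily i).isNearCone.insert_erase_mem G hG haG j hj,
          Finset.mem_insert_self _ _⟩
    obtain ⟨G, hG, haG⟩ := this
    have hs := Finset.singleton_subset_iff.2 haG
    exact mem_pureSkeleton.2 ⟨hC.down_closed G (facesOfDim_subset hG) _ hs, G, hG, hs⟩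
  · intro v hv
    exact (Finset.mem_Icc.1 (hC.subset_interval _ (mem_pureSkeleton.1 hv).1
      (Finset.mem_singleton_self v))).1

theorem facesOfDim_deletion (hC : IsSimplicialComplex (pureSkeleton C i)) :
    facesOfDim (deletion (pureSkeleton C i) p) i = delFamily p (facesOfDim C i) := by
  ext F
  rw [mem_facesOfDim, hC.mem_deletion, mem_delFamily, ← facesOfDim_pureSkeleton, mem_facesOfDim]
  tauto

/-- By purity an `(i-1)`-face `E` of the deletion lies in some `i`-face `E ∪ j`, and exchanging `j`
for `p` gives `E ∪ p`. Thus in this dimension deletion and link have the same faces. -/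
theorem facesOfDim_deletion_sub_one (hC : IsSimplicialComplex C)
    (hS : IsSimplicialComplex (pureSkeleton C i)) (hp : IsNearCone p (facesOfDim C i)) :
    facesOfDim (deletion (pureSkeleton C i) p) (i - 1) = linkFamily p (facesOfDim C i) := by
  ext E
  rw [mem_facesOfDim, hS.mem_deletion, mem_linkFamily, mem_pureSkeleton]
  constructor
  · rintro ⟨⟨⟨-, G, hG, hEG⟩, hpE⟩, hc⟩
    refine ⟨?_, hpE⟩
    have hGc := (mem_facesOfDim.1 hG).2
    obtain ⟨j, hjE, rfl⟩ : ∃ j ∉ E, insert j E = G := by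
      rw [← Finset.covBy_iff_exists_insert, Finset.covBy_iff_card_sdiff_eq_one]
      refine ⟨hEG, ?_⟩
      rw [Finset.card_sdiff_of_subset hEG]
      omega
    rcases eq_or_ne j p with rfl | hjp
    · exact hG
    · have := hp.insert_erase_mem _ hG (by simp [hjp.symm, hpE]) j (Finset.mem_insert_self j E)
      rwa [Finset.erase_insert hjE] at this
  · rintro ⟨hE, hpE⟩
    have hE' := mem_facesOfDim.1 hE
    refine ⟨⟨⟨hC.down_closed _ hE'.1 _ (Finset.subset_insert p E), _, hE,
      Finset.subset_insert p E⟩, hpE⟩, ?_⟩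
    rw [Finset.card_insert_of_notMem hpE] at hE'
    have := hE'.2
    push_cast at this
    omega

theorem facesOfDim_link (hS : IsSimplicialComplex (pureSkeleton C i)) :
    facesOfDim (link (pureSkeleton C i) p) (i - 1) = linkFamily p (facesOfDim C i) := by
  ext E
  rw [mem_facesOfDim, mem_link, mem_linkFamily, ← facesOfDim_pureSkeleton, mem_facesOfDim]
  constructor
  · rintro ⟨⟨-, hpE, hE⟩, hc⟩
    rw [Finset.card_insert_of_notMem hpE]
    push_cast
    exact ⟨⟨hE, by omega⟩, hpE⟩
  · rintro ⟨⟨hE, hc⟩, hpE⟩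
    rw [Finset.card_insert_of_notMem hpE] at hc
    push_cast at hc
    exact ⟨⟨hS.down_closed _ hE _ (Finset.subset_insert p E), hpE, hE⟩, by omega⟩

theorem finrank_range_boundary {K : Type*} [Field K] {R : Multiset (RatFun K)}
    {𝓖 : Finset (Finset ℤ)} (hC : IsSimplicialComplex C) (h : facesOfDim C (i + 1) = 𝓖)
    (hR : IsZSpectrum K 𝓖 a R) :
    Module.finrank ℤ (LinearMap.range (boundary C i).mulVecLin) = R.card := by
  subst h
  exact hR.finrank_range _ (hC.shadow_facesOfDim_subset i)

theorem FineShifted.IsSimplicialComplex.boundary_mul_boundary (hC : IsSimplicialComplex C)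
    (i : ℤ) : boundary C i * boundary C (i + 1) = 0 := by
  ext E G
  have := sum_incidence_mul_incidence (G := G.1) (fun j hj =>
    hC.shadow_facesOfDim_subset (i + 1) (Finset.erase_mem_shadow G.2 hj)) E.1
  rw [← Finset.sum_coe_sort] at this
  exact this

/-- Additivity of rank over `ℤ`, applied to the homology quotient and to the kernel of the boundary.
-/
theorem FineShifted.IsSimplicialComplex.bettiSucc_add (hC : IsSimplicialComplex C) (i : ℤ) :
    bettiSucc C i + Module.finrank ℤ (LinearMap.range (boundary C (i + 1)).mulVecLin) +
      Module.finrank ℤ (LinearMap.range (boundary C i).mulVecLin) =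
    (facesOfDim C (i + 1)).card := by
  have hle : LinearMap.range (boundary C (i + 1)).mulVecLin ≤
      LinearMap.ker (boundary C i).mulVecLin := by
    rw [LinearMap.range_le_ker_iff, ← Matrix.mulVecLin_mul, hC.boundary_mul_boundary,
      Matrix.mulVecLin_zero]
  have h1 := Submodule.finrank_quotient_add_finrank
    ((LinearMap.range (boundary C (i + 1)).mulVecLin).submoduleOf
      (LinearMap.ker (boundary C i).mulVecLin))
  rw [(Submodule.submoduleOfEquivOfLe hle).finrank_eq] at h1
  have h2 := Submodule.finrank_quotient_add_finrank (LinearMap.ker (boundary C i).mulVecLin)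
  rw [(boundary C i).mulVecLin.quotKerEquivRange.finrank_eq, Module.finrank_fintype_fun_eq_card, Fintype.card_coe] at h2
  rw [bettiSucc, h1, add_comm, h2]

end Complexes

/-! ### From families back to spectra of complexes. -/

section Spectrum

variable (K : Type*) [Field K]

theorem emb_injective : Function.Injective (emb K) :=
  FaithfulSMul.algebraMap_injective (RatFun K) (AlgebraicClosure (RatFun K))

theorem nonzeroPart_upDownSpectrum {C : Finset (Finset ℤ)} (hC : IsSimplicialComplex C)
    {a i : ℤ} (ha : ∀ F ∈ C, ∀ v ∈ F, a ≤ v) {𝓖 : Finset (Finset ℤ)}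
    (h : facesOfDim C i = 𝓖) {R : Multiset (RatFun K)} (hR : IsZSpectrum K 𝓖 a R) :
    nonzeroPart (upDownSpectrum K C (i - 1)) =
      R.map fun r => emb K (raisePow K (dimension C - i) r) := by
  obtain ⟨j, rfl⟩ : ∃ j, i = j + 1 := ⟨i - 1, by ring⟩
  subst h
  rw [add_sub_cancel_right, upDownSpectrum, upDownLaplacian_eq]
  have := (hR.hasNonzeroEigenvalues _ (hC.shadow_facesOfDim_subset j)
    fun E hE => ha E (facesOfDim_subset hE)).map (raiseHom K (dimension C - (j + 1)))
  rw [this.filter_aroots, Multiset.map_map]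
  rfl

theorem IsZSpectrum.eq_zero {𝓖 : Finset (Finset ℤ)} {a : ℤ} {R : Multiset (RatFun K)}
    (hR : IsZSpectrum K 𝓖 a R) (h : 𝓖 = ∅) : R = 0 := by
  subst h
  have := hR.finrank_range ∅ (by simp)
  rw [show incidenceMatrix ∅ ∅ = 0 from Subsingleton.elim _ _, Matrix.mulVecLin_zero,
    LinearMap.range_zero, finrank_bot] at this
  exact Multiset.card_eq_zero.1 this.symm

/-- Either there is an `i`-face, so the dimension is exactly `i` and the raising exponent is `0`, or
there are no nonzero eigenvalues to raise. -/
theorem nonzeroPart_upDownSpectrum_of_card_le {C : Finset (Finset ℤ)}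
    (hC : IsSimplicialComplex C) {a i : ℤ} (ha : ∀ F ∈ C, ∀ v ∈ F, a ≤ v)
    {𝓖 : Finset (Finset ℤ)} (h : facesOfDim C i = 𝓖) (hle : ∀ F ∈ C, (F.card : ℤ) ≤ i + 1)
    {R : Multiset (RatFun K)} (hR : IsZSpectrum K 𝓖 a R) :
    nonzeroPart (upDownSpectrum K C (i - 1)) = R.map (emb K) := by
  rw [nonzeroPart_upDownSpectrum K hC ha h hR]
  rcases 𝓖.eq_empty_or_nonempty with h0 | h0
  · rw [hR.eq_zero K h0, Multiset.map_zero, Multiset.map_zero]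
  · rw [dimension_eq (h ▸ h0) hle, sub_self]
    simp only [raisePow_zero]

theorem nonzeroPart_nonzeroPart {α : Type*} [Zero α] (M : Multiset α) :
    nonzeroPart (nonzeroPart M) = nonzeroPart M := by
  classical
  exact Multiset.filter_eq_self.2 fun _ h => (Multiset.mem_filter.1 h).2

theorem mem_nonzeroPart {α : Type*} [Zero α] {M : Multiset α} {r : α} :
    r ∈ nonzeroPart M ↔ r ∈ M ∧ r ≠ 0 := by
  classical
  rw [nonzeroPart, Multiset.mem_filter]

theorem Multiset.exists_map_eq {α β : Type*} {q : α → Prop} {f : α → β} (R : Multiset β)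
    (h : ∀ r ∈ R, ∃ P, q P ∧ f P = r) : ∃ A : Multiset α, (∀ P ∈ A, q P) ∧ A.map f = R := by
  induction R using Multiset.induction with
  | empty => exact ⟨0, by simp, rfl⟩
  | cons r R ih =>
    obtain ⟨P, hP, rfl⟩ := h r (Multiset.mem_cons_self r R)
    obtain ⟨A, hA, rfl⟩ := ih fun s hs => h s (Multiset.mem_cons_of_mem hs)
    exact ⟨P ::ₘ A, by simpa [hP] using hA, by simp⟩

theorem IsZSpectrum.exists_zPoly_multiset {C : Finset (Finset ℤ)} (hC : IsSimplicialComplex C)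
    {a i : ℤ} {𝓖 : Finset (Finset ℤ)} (h : facesOfDim C i = 𝓖) {R : Multiset (RatFun K)}
    (hR : IsZSpectrum K 𝓖 a R) :
    ∃ A : Multiset (Finset ℤ × Finset ℤ),
      (∀ P ∈ A, (P.1 : Set ℤ) ⊆ vertices C ∧ (P.2 : Set ℤ) ⊆ vertices C) ∧
      A.map (fun P => emb K (zPoly K P.1.val P.2.val)) = R.map (emb K) := by
  subst h
  refine Multiset.exists_map_eq _ fun s hs => ?_
  obtain ⟨r, hr, rfl⟩ := Multiset.mem_map.1 hs
  obtain ⟨S, T, hS, hT, rfl⟩ := hR.exists_zPoly r hr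
  exact ⟨(S, T), ⟨hC.sup_facesOfDim_subset hS, hC.sup_facesOfDim_subset hT⟩, rfl⟩

end Spectrum

theorem theorem7p2 (K : Type*) [Field K] [CharZero K] (C : Finset (Finset ℤ)) (a b : ℤ)
    (hC : IsShiftedComplex C a b) :
    -- every nonzero eigenvalue is a raised z-polynomial
    (∀ i : ℤ, ∀ r ∈ upDownSpectrum K C (i - 1), r ≠ 0 →
      ∃ S T : Finset ℤ, (S : Set ℤ) ⊆ vertices C ∧ (T : Set ℤ) ⊆ vertices C ∧
        r = emb K (raisePow K (dimension C - i) (zPoly K S.val T.val))) ∧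
    -- a complex without vertices has no nonzero eigenvalues
    (vertices C = ∅ → ∀ i : ℤ, ∀ r ∈ upDownSpectrum K C (i - 1), r = 0) ∧
    -- the pure skeleton has an initial vertex, and the recurrence holds
    (∀ i : ℤ, 0 ≤ i → i ≤ dimension C →
      ∃ p : ℤ, IsLeast (vertices (pureSkeleton C i)) p ∧
        -- the nonzero eigenvalues of the deletion are z-polynomials, with no raising
        (∃ A : Multiset (Finset ℤ × Finset ℤ),
          (∀ P ∈ A, (P.1 : Set ℤ) ⊆ vertices (deletion (pureSkeleton C i) p) ∧
            (P.2 : Set ℤ) ⊆ vertices (deletion (pureSkeleton C i) p)) ∧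
          A.map (fun P => emb K (zPoly K P.1.val P.2.val)) =
            nonzeroPart (upDownSpectrum K (deletion (pureSkeleton C i) p) (i - 1))) ∧
        -- the nonzero eigenvalues of the link are z-polynomials, with no raising
        (∃ B : Multiset (Finset ℤ × Finset ℤ),
          (∀ P ∈ B, (P.1 : Set ℤ) ⊆ vertices (link (pureSkeleton C i) p) ∧
            (P.2 : Set ℤ) ⊆ vertices (link (pureSkeleton C i) p)) ∧
          B.map (fun P => emb K (zPoly K P.1.val P.2.val)) =
            nonzeroPart (upDownSpectrum K (link (pureSkeleton C i) p) (i - 2))) ∧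
        -- the recurrence, for every way of writing these eigenvalues as z-polynomials
        ∀ A B : Multiset (Finset ℤ × Finset ℤ),
          (∀ P ∈ A, (∀ s ∈ P.1, p < s) ∧ (∀ t ∈ P.2, p < t)) →
          (∀ P ∈ B, (∀ s ∈ P.1, p < s) ∧ (∀ t ∈ P.2, p < t)) →
          A.map (fun P => emb K (zPoly K P.1.val P.2.val)) =
            nonzeroPart (upDownSpectrum K (deletion (pureSkeleton C i) p) (i - 1)) →
          B.map (fun P => emb K (zPoly K P.1.val P.2.val)) =
            nonzeroPart (upDownSpectrum K (link (pureSkeleton C i) p) (i - 2)) →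
          EqUpToZero (upDownSpectrum K C (i - 1))
            (A.map (fun P => emb K (raisePow K (dimension C - i)
                (zPoly K P.1.val (insert p P.2).val))) +
              B.map (fun P => emb K (raisePow K (dimension C - i)
                (zPoly K (insert p P.1).val (insert p P.2).val))) +
              Multiset.replicate (bettiSucc (deletion (pureSkeleton C i) p) (i - 2))
                (emb K (raisePow K (dimension C - i) (zPoly K ∅ {p}))))) := by
  have hge : ∀ F ∈ C, ∀ v ∈ F, a ≤ v := fun F hF v hv =>
    (Finset.mem_Icc.1 (hC.subset_interval F hF hv)).1
  have hform : ∀ i : ℤ, ∀ r ∈ upDownSpectrum K C (i - 1), r ≠ 0 →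
      ∃ S T : Finset ℤ, (S : Set ℤ) ⊆ vertices C ∧ (T : Set ℤ) ⊆ vertices C ∧
        r = emb K (raisePow K (dimension C - i) (zPoly K S.val T.val)) := by
    intro i r hr hr0
    obtain ⟨R, hR⟩ := (hC.isShiftedFamily i).exists_isZSpectrum K
    have hr' : r ∈ nonzeroPart (upDownSpectrum K C (i - 1)) := mem_nonzeroPart.2 ⟨hr, hr0⟩
    rw [nonzeroPart_upDownSpectrum K hC.toIsSimplicialComplex hge rfl hR] at hr'
    obtain ⟨s, hs, rfl⟩ := Multiset.mem_map.1 hr'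
    obtain ⟨S, T, hS, hT, rfl⟩ := hR.exists_zPoly s hs
    exact ⟨S, T, hC.sup_facesOfDim_subset hS, hC.sup_facesOfDim_subset hT, rfl⟩
  refine ⟨hform, fun hv i r hr => ?_, fun i h0 hi => ?_⟩
  · by_contra hr0
    obtain ⟨S, T, -, hT, rfl⟩ := hform i r hr hr0
    -- Without vertices `T = ∅`, so the sum defining `z(S, T)` is empty.
    rw [hv, Set.subset_empty_iff, Finset.coe_eq_empty] at hT
    rw [hT, Finset.empty_val, zPoly_zero_right, raisePow_eq_raiseHom, map_zero, emb, map_zero]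
      at hr0
    exact hr0 rfl
  have hne := hC.facesOfDim_nonempty h0 hi
  have hfam := hC.isShiftedFamily i
  have hcone := hfam.isNearCone
  have hS := hC.pureSkeleton hne
  have hleast := hC.isLeast_vertices_pureSkeleton h0 hne
  have hdel := hS.deletion a
  have hlink := hS.link hleast.1
  have hskel : ∀ F ∈ pureSkeleton C i, a ∉ F → ∀ v ∈ F, a + 1 ≤ v := fun F hF haF v hv =>
    lt_of_le_of_ne (hge F (mem_pureSkeleton.1 hF).1 v hv) fun e => haF (e ▸ hv)
  obtain ⟨R, hR⟩ := hfam.delFamily.exists_isZSpectrum K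
  obtain ⟨Q, hQ⟩ := hfam.linkFamily.exists_isZSpectrum K
  obtain ⟨hcard, hrec⟩ := IsZSpectrum.recurrence hfam hR hQ
  have hspecD : nonzeroPart (upDownSpectrum K (deletion (pureSkeleton C i) a) (i - 1)) =
      R.map (emb K) := by
    refine nonzeroPart_upDownSpectrum_of_card_le K hdel (fun F hF => ?_)
      (facesOfDim_deletion hS) (fun F hF => ?_) hR
    · rw [hS.mem_deletion] at hF
      exact hskel F hF.1 hF.2
    · exact card_le_of_mem_pureSkeleton (hS.mem_deletion.1 hF).1
  have hspecL : nonzeroPart (upDownSpectrum K (link (pureSkeleton C i) a) (i - 2)) =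
      Q.map (emb K) := by
    rw [show i - 2 = i - 1 - 1 by ring]
    refine nonzeroPart_upDownSpectrum_of_card_le K hlink (fun F hF => ?_)
      (facesOfDim_link hS) (fun F hF => ?_) hQ
    · rw [mem_link] at hF
      exact hskel F hF.1 hF.2.1
    · rw [mem_link] at hF
      have := card_le_of_mem_pureSkeleton hF.2.2
      rw [Finset.card_insert_of_notMem hF.2.1] at this
      push_cast at this
      omega
  -- `bettiSucc` at `i - 2` is the Betti number in degree `i - 1`. The chain group has rank
  -- `|linkFamily|`; the outgoing boundary of `Δ` has rank `|Q|` and the incoming one `|R|`.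
  have hbetti : bettiSucc (deletion (pureSkeleton C i) a) (i - 2) =
      (linkFamily a (facesOfDim C i)).card - R.card - Q.card := by
    have hlinkD := facesOfDim_deletion_sub_one hC.toIsSimplicialComplex hS hcone
    have h1 := hdel.bettiSucc_add (i - 2)
    rw [finrank_range_boundary (i := i - 2) hdel
        (show _ = linkFamily a (facesOfDim C i) by rw [← hlinkD]; congr 1; ring) hQ,
      finrank_range_boundary (i := i - 2 + 1) hdel
        (show _ = delFamily a (facesOfDim C i) by rw [← facesOfDim_deletion hS]; congr 1; ring)
        hR, show i - 2 + 1 = i - 1 by ring, hlinkD] at h1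
    omega
  refine ⟨a, hleast, hspecD ▸ hR.exists_zPoly_multiset K hdel (facesOfDim_deletion hS),
    hspecL ▸ hQ.exists_zPoly_multiset K hlink (facesOfDim_link hS), ?_⟩
  intro A B hA hB hAR hBQ
  rw [hspecD] at hAR
  rw [hspecL] at hBQ
  -- The recurrence sees only the values of the `z`-polynomials, and these are fixed by injectivity
  -- of `emb`, so every way of writing them works.
  have hAR' : A.map (fun P => zPoly K P.1.val P.2.val) = R := by
    apply Multiset.map_injective (emb_injective K)
    rw [← hAR, Multiset.map_map]
    rfl
  have hBQ' : B.map (fun P => zPoly K P.1.val P.2.val) = Q := by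
    apply Multiset.map_injective (emb_injective K)
    rw [← hBQ, Multiset.map_map]
    rfl
  have hmain := nonzeroPart_upDownSpectrum K hC.toIsSimplicialComplex hge (i := i) rfl hrec
  -- With `nonzeroPart` applied twice on the left, it suffices to match the multisets inside;
  -- nonvanishing of the right-hand values needs no separate check.
  rw [EqUpToZero, ← nonzeroPart_nonzeroPart, hmain, hbetti]
  congr 1
  rw [Multiset.map_add, Multiset.map_add, Multiset.map_replicate, Multiset.map_map,
    Multiset.map_map, ← hAR', ← hBQ', Multiset.map_map, Multiset.map_map, Multiset.card_map,
    Multiset.card_map, ← zPoly_empty_singleton]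
  congr 2
  · refine Multiset.map_congr rfl fun P hP => ?_
    simp only [Function.comp_apply]
    rw [zPoly_insert_right K (hA P hP).1 (hA P hP).2, zPoly_empty_singleton]
  · refine Multiset.map_congr rfl fun P hP => ?_
    simp only [Function.comp_apply]
    rw [zPoly_insert_insert K (hB P hP).1 (hB P hP).2, zPoly_empty_singleton]
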